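/- **Theorem 4.18.** Let $\mathbb{k}$ be a commutative unital ring, $A$ an associative unital $\mathbb{k}$-algebra, $\Omega^\bullet$ an exterior algebra over $A$ (a differential graded $\mathbb{k}$-algebra with $\Omega^0=A$ whose degree $m$ part is spanned by the forms $a_0\,da_1\wedge\cdots\wedge da_m$), and $E$ a left $A$-module. Write $\Omega^mF=\Omega^m\otimes_AF$ for a left $A$-module $F$, and use the following notions. * $J^1A=(A\otimes_{\mathbb k}A)/\{\sum a_i\otimes b_i:\sum a_ib_i=0,\ \sum a_i\,db_i=0\}$ and $J^1F=J^1A\otimes_AF$, with $\pi^{1,0}([a\otimes b]\otimes f)=abf$, prolongation $j^1(f)=[1\otimes1]\otimes f$, and $\iota^1:\Omega^1F\to J^1F$, $a\,db\otimes f\mapsto[a\otimes b-ab\otimes1]\otimes f$. * Holonomic jets: $J^0E=E$, $J^1E$ as above, and for $n\ge2$ the submodule $l^{1,n-1}:J^nE\hookrightarrow J^1J^{n-1}E$ is the kernel of the composite of $J^1(l^{1,n-2}):J^1J^{n-1}E\to J^1J^1J^{n-2}E$ with the map to $\Omega^1J^{n-2}E\times\Omega^2J^{n-2}E$ given by $[a\otimes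 b]\otimes[c\otimes e]\otimes\xi\mapsto(a\,d(bc)e\otimes\xi,\ da\wedge d(bc)e\otimes\xi)$; here $l^{1,0}=\mathrm{id}$. Put $\pi^{n,n-1}=\pi^{1,0}_{J^{n-1}E}\circ l^{1,n-1}$, and let $j^n:E\to J^nE$ be determined by $j^0=\mathrm{id}$, $l^{1,n-1}\circ j^n=j^1_{J^{n-1}E}\circ j^{n-1}$. * Symmetric forms: $S^0E=E$, $S^1E=\Omega^1E$, and for $n\ge2$ the submodule $\iota^n_\wedge:S^nE\hookrightarrow\Omega^1S^{n-1}E$ is the kernel of $\wedge\circ\Omega^1(\iota_\wedge^{n-1}):\Omega^1S^{n-1}E\to\Omega^2S^{n-2}E$; $\iota^1_\wedge=\mathrm{id}$. The map $\iota^n:S^nE\to J^nE$ is determined by $\iota^0=\mathrm{id}$, $l^{1,n-1}\circ\iota^n=\iota^1_{J^{n-1}E}\circ\Omega^1(\iota^{n-1})\circ\iota^n_\wedge$. The $n$-jet sequence at $E$ is $0\to S^nE\xrightarrow{\iota^n}J^nE\xrightarrow{\pi^{n,n-1}}J^{n-1}E\to0$. * The Spencer operator $\mathcal S^{n,0}:J^nE\to\Omega^1J^{n-1}E$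 maps $\sum_i[y_i\otimes z_i]\otimes\xi_i$, viewed in $J^1J^{n-1}E$, to $\sum_i(dy_i)z_i\otimes\xi_i$. * An $n$-connection on $E$ is an $A$-linear map $C^n:J^{n-1}E\to J^nE$ with $\pi^{n,n-1}\circ C^n=\mathrm{id}$. A connection on $F$ is a $\mathbb k$-linear map $\nabla:F\to\Omega^1F$ with $\nabla(af)=da\otimes f+a\nabla f$; its curvature is $R_\nabla=d_\nabla\circ\nabla:F\to\Omega^2F$, where $d_\nabla(\omega\otimes f)=d\omega\otimes f-\omega\wedge\nabla f$ on $\Omega^1F$. Let $n\ge1$. Assume that $n=1$, or that $n>1$ and * $\Omega^1$ and $\Omega^2$ are flat as right $A$-modules; * $J^nE$ is generated as a left $A$-module by $j^n(E)$ (all $n$-jets are elemental); * the $n$-jet sequence at $E$ is exact; * if $n\ge3$, the $(n-1)$-jet sequence at $E$ is left exact; * if $n\ge4$, the map $\iota^{n-2}:S^{n-2}E\to J^{n-2}E$ is injective. Then $C^n\mapsto\nabla^{C^n}:=\mathcal S^{n,0}\circ C^n$ is a bijection from the set of $n$-connections on $E$ onto the set of connections $\nabla$ on $J^{n-1}E$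 such that 1. $\Omega^1(\pi^{n-1,n-2})\circ\nabla=\mathcal S^{n-1,0}$ (no condition if $n=1$); 2. $R_\nabla$ takes values in $\Omega^2S^{n-1}E$, that is, in the image of $\Omega^2(\iota^{n-1}):\Omega^2S^{n-1}E\to\Omega^2J^{n-1}E$. The inverse is described as follows. For every connection $\nabla$ on $J^{n-1}E$ satisfying 1 and 2 there is a unique map $\nabla^n:E\to S^nE$ with $$\Omega^1(\iota^{n-1})\circ\iota^n_\wedge\circ\nabla^n=\nabla\circ j^{n-1}.$$ It is a $\mathbb k$-linear differential operator of order at most $n$: there is an $A$-linear map $\widetilde\nabla^n:J^nE\to S^nE$ with $\widetilde\nabla^n\circ j^n=\nabla^n$. This lift is unique, it satisfies $\widetilde\nabla^n\circ\iota^n=\mathrm{id}_{S^nE}$, and the $n$-connection $C^n$ corresponding to $\nabla$ is the one with $$C^n\circ\pi^{n,n-1}+\iota^n\circ\widetilde\nabla^n=\mathrm{id}_{J^nE}.$$ Moreover $l^{1,n-1}\circ C^n=j^1_{J^{n-1}E}-\iota^1_{J^{n-1}E}\circ\nabla^{C^n}$; for $n=1$ this reads $C^1=j^1-\iota^1\circ\nabla^{C^1}$,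 so that the correspondence extends the standard one between connections on $E$ and splittings of the $1$-jet sequence. -/

import Mathlib

open MulOpposite
open scoped TensorProduct

universe v u

noncomputable section

namespace NCJet

/-! ### The tensor product over a noncommutative ring -/

section BalancedTensor

variable (A : Type u) [Ring A]
variable (M : Type u) [AddCommGroup M] [Module A M] [Module Aᵐᵒᵖ M]
variable (E : Type u) [AddCommGroup E] [Module A E]

/-- The relations `m a ⊗ e = m ⊗ a e`. For a bimodule `M` the set of generators is stable under
the left action, so that their left span is the additive subgroup that they generate. -/
def balancedRel : Submodule A (M ⊗[ℤ] E) :=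
  Submodule.span A {t | ∃ (m : M) (a : A) (e : E), t = (op a • m) ⊗ₜ[ℤ] e - m ⊗ₜ[ℤ] (a • e)}

/-- The tensor product `M ⊗_A E` of an `A`-bimodule `M` and a left `A`-module `E`, as a left
`A`-module. The right action of `A` on `M` is written as an action of `Aᵐᵒᵖ`. -/
def BTensor : Type u := (M ⊗[ℤ] E) ⧸ balancedRel A M E

instance : AddCommGroup (BTensor A M E) :=
  inferInstanceAs (AddCommGroup ((M ⊗[ℤ] E) ⧸ balancedRel A M E))

instance : Module A (BTensor A M E) :=
  inferInstanceAs (Module A ((M ⊗[ℤ] E) ⧸ balancedRel A M E))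

variable {M E}

/-- The pure tensor `m ⊗_A e`. -/
def btmul (m : M) (e : E) : BTensor A M E :=
  Submodule.Quotient.mk (p := balancedRel A M E) (m ⊗ₜ[ℤ] e)

variable {A}

theorem btmul_add (m : M) (e e' : E) :
    btmul A m (e + e') = btmul A m e + btmul A m e' := by
  unfold btmul; rw [TensorProduct.tmul_add]; rfl

theorem add_btmul (m m' : M) (e : E) :
    btmul A (m + m') e = btmul A m e + btmul A m' e := by
  unfold btmul; rw [TensorProduct.add_tmul]; rfl

theorem smul_btmul (a : A) (m : M) (e : E) : a • btmul A m e = btmul A (a • m) e := rfl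

theorem btmul_smul (m : M) (a : A) (e : E) :
    btmul A m (a • e) = btmul A (op a • m) e := by
  symm
  exact (Submodule.Quotient.eq (balancedRel A M E)).2 (Submodule.subset_span ⟨m, a, e, rfl⟩)

variable (A) in
/-- The biadditive map `(m, e) ↦ m ⊗_A e`. -/
def btmulHom : M →+ E →+ BTensor A M E :=
  AddMonoidHom.mk' (fun m => AddMonoidHom.mk' (fun e => btmul A m e) (btmul_add m))
    (fun m m' => by ext e; exact add_btmul m m' e)

@[simp] theorem btmulHom_apply (m : M) (e : E) : btmulHom A m e = btmul A m e := rfl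

theorem btensor_induction {p : BTensor A M E → Prop} (x : BTensor A M E)
    (zero : p 0) (tmul : ∀ m e, p (btmul A m e)) (add : ∀ x y, p x → p y → p (x + y)) : p x := by
  obtain ⟨t, rfl⟩ := Submodule.Quotient.mk_surjective _ x
  induction t using TensorProduct.induction_on with
  | zero => exact zero
  | tmul m e => exact tmul m e
  | add s t hs ht => exact add _ _ hs ht

theorem btensor_hom_ext {G : Type*} [AddCommGroup G] {f g : BTensor A M E →+ G}
    (h : ∀ m e, f (btmul A m e) = g (btmul A m e)) : f = g := by
  ext x
  induction x using btensor_induction with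
  | zero => simp
  | tmul m e => exact h m e
  | add x y hx hy => rw [map_add, map_add, hx, hy]

/-- The additive map on `M ⊗_A E` induced by an `A`-balanced biadditive map. -/
def btensorLift [SMulCommClass A Aᵐᵒᵖ M] {G : Type*} [AddCommGroup G] (f : M →+ E →+ G)
    (hf : ∀ (m : M) (a : A) (e : E), f (op a • m) e = f m (a • e)) : BTensor A M E →+ G :=
  QuotientAddGroup.lift (balancedRel A M E).toAddSubgroup
    (TensorProduct.liftAddHom (R := ℤ) f (fun r m e => by simp)) (by
      intro t ht
      have key : ∀ t ∈ balancedRel A M E, ∀ a : A,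
          (TensorProduct.liftAddHom (R := ℤ) f (fun r m e => by simp)) (a • t) = 0 := by
        intro t ht
        induction ht using Submodule.span_induction with
        | mem x hx =>
          obtain ⟨m, b, e, rfl⟩ := hx
          intro a
          rw [smul_sub, TensorProduct.smul_tmul', TensorProduct.smul_tmul', map_sub,
            TensorProduct.liftAddHom_tmul, TensorProduct.liftAddHom_tmul, smul_comm a (op b) m,
            hf, sub_self]
        | zero => intro a; simp
        | add x y _ _ hx hy => intro a; rw [smul_add, map_add, hx, hy, add_zero]
        | smul c x _ hx => intro a; rw [smul_smul]; exact hx _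
      have := key t ht 1
      rwa [one_smul] at this)

@[simp] theorem btensorLift_btmul [SMulCommClass A Aᵐᵒᵖ M] {G : Type*} [AddCommGroup G]
    (f : M →+ E →+ G) (hf : ∀ (m : M) (a : A) (e : E), f (op a • m) e = f m (a • e))
    (m : M) (e : E) : btensorLift f hf (btmul A m e) = f m e := rfl

variable (M) in
/-- The functor `M ⊗_A -` on a morphism `φ`: the map `m ⊗ e ↦ m ⊗ φ e`. -/
def btensorMap [SMulCommClass A Aᵐᵒᵖ M] {F : Type u} [AddCommGroup F] [Module A F]
    (φ : E →ₗ[A] F) : BTensor A M E →ₗ[A] BTensor A M F where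
  toFun := btensorLift (AddMonoidHom.mk' (fun m => (btmulHom A m).comp φ.toAddMonoidHom)
      (fun m m' => by ext e; simp))
    (fun m a e => by simp [btmul_smul])
  map_add' := map_add _
  map_smul' a x := by
    induction x using btensor_induction with
    | zero => simp
    | tmul m e => simp [smul_btmul]
    | add x y hx hy => simp only [smul_add, map_add, hx, hy]

@[simp] theorem btensorMap_btmul [SMulCommClass A Aᵐᵒᵖ M] {F : Type u} [AddCommGroup F]
    [Module A F] (φ : E →ₗ[A] F) (m : M) (e : E) :
    btensorMap M φ (btmul A m e) = btmul A m (φ e) := rfl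

end BalancedTensor

/-- Flatness of the right `A`-module underlying `M`: the functor `M ⊗_A -` preserves injections of
left `A`-modules. -/
def IsRightFlat (A : Type u) [Ring A] (M : Type u) [AddCommGroup M] [Module A M] [Module Aᵐᵒᵖ M]
    [SMulCommClass A Aᵐᵒᵖ M] : Prop :=
  ∀ (E F : Type u) [AddCommGroup E] [Module A E] [AddCommGroup F] [Module A F] (φ : E →ₗ[A] F),
    Function.Injective φ → Function.Injective (btensorMap M φ)

/-! ### Exterior algebras -/

/-- An exterior algebra over the `k`-algebra `A`: a differential graded `k`-algebra with degree
zero part `A`, whose degree `m` part is spanned by the forms `a₀ ∧ da₁ ∧ ⋯ ∧ daₘ`. -/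
structure ExtAlg (k : Type v) (A : Type u) [CommRing k] [Ring A] [Algebra k A] where
  /-- the total algebra, whose product is the wedge product -/
  carrier : Type u
  [ring : Ring carrier]
  [algebra : Algebra k carrier]
  /-- the homogeneous components -/
  grade : ℕ → Submodule k carrier
  [graded : GradedAlgebra grade]
  /-- the identification of `A` with the component of degree zero -/
  incl : A →ₐ[k] carrier
  incl_injective : Function.Injective incl
  mem_grade_zero : ∀ x, x ∈ grade 0 ↔ ∃ a, incl a = x
  /-- the exterior derivative -/
  diff : carrier →ₗ[k] carrier
  diff_mem : ∀ m, ∀ x ∈ grade m, diff x ∈ grade (m + 1)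
  diff_diff : ∀ x, diff (diff x) = 0
  diff_mul : ∀ m, ∀ x ∈ grade m, ∀ y, diff (x * y) = diff x * y + (-1) ^ m * (x * diff y)
  grade_le_span : ∀ m, grade m ≤ Submodule.span k
    {x | ∃ (a : A) (b : Fin m → A), x = incl a * (List.ofFn fun i => diff (incl (b i))).prod}

namespace ExtAlg

variable {k : Type v} {A : Type u} [CommRing k] [Ring A] [Algebra k A] (X : ExtAlg k A)

instance : Ring X.carrier := X.ring
instance : Algebra k X.carrier := X.algebra
instance : GradedAlgebra X.grade := X.graded

/-- The bimodule of `m`-forms. -/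
def Form (m : ℕ) : Type u := X.grade m

instance (m : ℕ) : AddCommGroup (X.Form m) := inferInstanceAs (AddCommGroup (X.grade m))

/-- An `m`-form as an element of the total algebra. -/
def val {m : ℕ} : X.Form m →+ X.carrier := (X.grade m).subtype.toAddMonoidHom

variable {X} in
theorem form_ext {m : ℕ} {x y : X.Form m} (h : X.val x = X.val y) : x = y := Subtype.ext h

theorem val_mem {m : ℕ} (x : X.Form m) : X.val x ∈ X.grade m := x.2

theorem incl_mem (a : A) : X.incl a ∈ X.grade 0 := (X.mem_grade_zero _).2 ⟨a, rfl⟩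

theorem incl_mul_mem (a : A) {m : ℕ} {x : X.carrier} (hx : x ∈ X.grade m) :
    X.incl a * x ∈ X.grade m := by
  have := SetLike.mul_mem_graded (X.incl_mem a) hx
  rwa [zero_add] at this

theorem mul_incl_mem (a : A) {m : ℕ} {x : X.carrier} (hx : x ∈ X.grade m) :
    x * X.incl a ∈ X.grade m := SetLike.mul_mem_graded hx (X.incl_mem a)

instance (m : ℕ) : Module A (X.Form m) where
  smul a x := ⟨X.incl a * X.val x, X.incl_mul_mem a x.2⟩
  one_smul x := form_ext (show X.incl 1 * X.val x = X.val x by simp)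
  mul_smul a b x := form_ext (show X.incl (a * b) * X.val x = X.incl a * (X.incl b * X.val x) by
    simp [mul_assoc])
  smul_zero a := form_ext (show X.incl a * X.val (0 : X.Form m) = X.val 0 by simp)
  smul_add a x y := form_ext (show X.incl a * X.val (x + y) =
    X.incl a * X.val x + X.incl a * X.val y by simp [mul_add])
  add_smul a b x := form_ext (show X.incl (a + b) * X.val x =
    X.incl a * X.val x + X.incl b * X.val x by simp [add_mul])
  zero_smul x := form_ext (show X.incl 0 * X.val x = X.val (0 : X.Form m) by simp)

instance (m : ℕ) : Module Aᵐᵒᵖ (X.Form m) where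
  smul a x := ⟨X.val x * X.incl a.unop, X.mul_incl_mem _ x.2⟩
  one_smul x := form_ext (show X.val x * X.incl 1 = X.val x by simp)
  mul_smul a b x := form_ext (show X.val x * X.incl (b.unop * a.unop) =
    X.val x * X.incl b.unop * X.incl a.unop by simp [mul_assoc])
  smul_zero a := form_ext (show X.val (0 : X.Form m) * X.incl a.unop = X.val 0 by simp)
  smul_add a x y := form_ext (show X.val (x + y) * X.incl a.unop =
    X.val x * X.incl a.unop + X.val y * X.incl a.unop by simp [add_mul])
  add_smul a b x := form_ext (show X.val x * X.incl (a.unop + b.unop) =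
    X.val x * X.incl a.unop + X.val x * X.incl b.unop by simp [mul_add])
  zero_smul x := form_ext (show X.val x * X.incl 0 = X.val (0 : X.Form m) by simp)

@[simp] theorem val_smul {m : ℕ} (a : A) (x : X.Form m) :
    X.val (a • x) = X.incl a * X.val x := rfl

@[simp] theorem val_op_smul {m : ℕ} (a : A) (x : X.Form m) :
    X.val (op a • x) = X.val x * X.incl a := rfl

instance (m : ℕ) : SMulCommClass A Aᵐᵒᵖ (X.Form m) where
  smul_comm a b x := form_ext (show X.incl a * (X.val x * X.incl b.unop) =
    X.incl a * X.val x * X.incl b.unop by rw [mul_assoc])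

/-- The differential `d : A → Ω¹`. -/
def d0 : A →+ X.Form 1 :=
  AddMonoidHom.mk' (fun a => ⟨X.diff (X.incl a), X.diff_mem 0 _ (X.incl_mem a)⟩)
    (fun a b => form_ext (show X.diff (X.incl (a + b)) = X.diff (X.incl a) + X.diff (X.incl b) by
      simp))

@[simp] theorem val_d0 (a : A) : X.val (X.d0 a) = X.diff (X.incl a) := rfl

/-- The differential `d : Ωᵐ → Ωᵐ⁺¹`. -/
def dForm (m : ℕ) : X.Form m →+ X.Form (m + 1) :=
  AddMonoidHom.mk' (fun x => ⟨X.diff (X.val x), X.diff_mem m _ x.2⟩)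
    (fun x y => form_ext (show X.diff (X.val (x + y)) = X.diff (X.val x) + X.diff (X.val y) by
      simp))

@[simp] theorem val_dForm {m : ℕ} (x : X.Form m) : X.val (X.dForm m x) = X.diff (X.val x) := rfl

/-- The wedge product of an `m`-form and an `n`-form. -/
def wedge (m n : ℕ) : X.Form m →+ X.Form n →+ X.Form (m + n) :=
  AddMonoidHom.mk' (fun x => AddMonoidHom.mk'
      (fun y => ⟨X.val x * X.val y, SetLike.mul_mem_graded x.2 y.2⟩)
      (fun y y' => form_ext (show X.val x * X.val (y + y') = X.val x * X.val y + X.val x * X.val y'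
        by simp [mul_add])))
    (fun x x' => by
      ext y
      exact form_ext (show X.val (x + x') * X.val y = X.val x * X.val y + X.val x' * X.val y
        by simp [add_mul]))

@[simp] theorem val_wedge {m n : ℕ} (x : X.Form m) (y : X.Form n) :
    X.val (X.wedge m n x y) = X.val x * X.val y := rfl

theorem d0_mul (a b : A) : X.d0 (a * b) = op b • X.d0 a + a • X.d0 b :=
  form_ext (by simp [X.diff_mul 0 _ (X.incl_mem a)])

/-! ### Differential forms with values in a module -/

section FormsWithValues

variable {F : Type u} [AddCommGroup F] [Module A F]
variable {G : Type u} [AddCommGroup G] [Module A G]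

/-- The left module `Ωᵐ F = Ωᵐ ⊗_A F`. -/
abbrev Om (m : ℕ) (F : Type u) [AddCommGroup F] [Module A F] : Type u := BTensor A (X.Form m) F

/-- The functor `Ωᵐ` on morphisms. -/
abbrev OmMap (m : ℕ) (φ : F →ₗ[A] G) : X.Om m F →ₗ[A] X.Om m G := btensorMap (X.Form m) φ

/-- `ω ∧ ξ` for `ω ∈ Ωᵐ` and `ξ ∈ Ωⁿ F`, determined by `ω ∧ (α ⊗ f) = (ω ∧ α) ⊗ f`. -/
def wedgeLeft (m n : ℕ) (F : Type u) [AddCommGroup F] [Module A F] :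
    X.Form m →+ X.Om n F →+ X.Om (m + n) F :=
  AddMonoidHom.mk' (fun ω => btensorLift ((btmulHom A).comp (X.wedge m n ω))
      (fun α a f => by
        simp only [AddMonoidHom.comp_apply, btmulHom_apply, btmul_smul]
        congr 1
        exact form_ext (by simp [mul_assoc])))
    (fun ω ω' => btensor_hom_ext (fun α f => by simp))

@[simp] theorem wedgeLeft_btmul {m n : ℕ} (ω : X.Form m) (α : X.Form n) (f : F) :
    X.wedgeLeft m n F ω (btmul A α f) = btmul A (X.wedge m n ω α) f := rfl

theorem wedgeLeft_op_smul {m n : ℕ} (ω : X.Form m) (a : A) (ξ : X.Om n F) :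
    X.wedgeLeft m n F (op a • ω) ξ = X.wedgeLeft m n F ω (a • ξ) := by
  induction ξ using btensor_induction with
  | zero => simp
  | tmul α f =>
    simp only [smul_btmul, wedgeLeft_btmul]
    congr 1
    exact form_ext (by simp [mul_assoc])
  | add x y hx hy => simp only [smul_add, map_add, hx, hy]

theorem wedgeLeft_smul {m n : ℕ} (ω : X.Form m) (a : A) (ξ : X.Om n F) :
    X.wedgeLeft m n F (a • ω) ξ = a • X.wedgeLeft m n F ω ξ := by
  induction ξ using btensor_induction with
  | zero => simp
  | tmul α f =>
    simp only [smul_btmul, wedgeLeft_btmul]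
    congr 1
    exact form_ext (by simp [mul_assoc])
  | add x y hx hy => simp only [smul_add, map_add, hx, hy]

theorem wedgeLeft_map {m n : ℕ} (ω : X.Form m) (φ : F →ₗ[A] G) (ξ : X.Om n F) :
    X.wedgeLeft m n G ω (X.OmMap n φ ξ) = X.OmMap (m + n) φ (X.wedgeLeft m n F ω ξ) := by
  induction ξ using btensor_induction with
  | zero => simp
  | tmul α f => rfl
  | add x y hx hy => simp only [map_add, hx, hy]

/-- The wedge map `Ωᵐ Ωⁿ F → Ωᵐ⁺ⁿ F`, `ω ⊗ α ⊗ f ↦ (ω ∧ α) ⊗ f`. -/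
def wedgeT (m n : ℕ) (F : Type u) [AddCommGroup F] [Module A F] :
    X.Om m (X.Om n F) →ₗ[A] X.Om (m + n) F where
  toFun := btensorLift (X.wedgeLeft m n F) (fun ω a ξ => X.wedgeLeft_op_smul ω a ξ)
  map_add' := map_add _
  map_smul' a x := by
    induction x using btensor_induction with
    | zero => simp
    | tmul ω ξ => exact X.wedgeLeft_smul ω a ξ
    | add x y hx hy => simp only [smul_add, map_add, hx, hy]

@[simp] theorem wedgeT_btmul {m n : ℕ} (ω : X.Form m) (ξ : X.Om n F) :
    X.wedgeT m n F (btmul A ω ξ) = X.wedgeLeft m n F ω ξ := rfl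

/-- For an additive map `s : G → Ω¹ F` satisfying `s (a x) = da ⊗ p x + a s x`, the induced map
`Ωᵐ G → Ωᵐ⁺¹ F`, `ω ⊗ x ↦ dω ⊗ p x + (-1)ᵐ ω ∧ s x`. -/
def extend (m : ℕ) (p : G →ₗ[A] F) (s : G →+ X.Om 1 F)
    (hs : ∀ (a : A) (x : G), s (a • x) = btmul A (X.d0 a) (p x) + a • s x) :
    X.Om m G →+ X.Om (m + 1) F :=
  btensorLift
    (AddMonoidHom.mk'
      (fun ω => ((btmulHom A (X.dForm m ω)).comp p.toAddMonoidHom +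
        (-1 : ℤ) ^ m • (X.wedgeLeft m 1 F ω).comp s))
      (fun ω ω' => by
        ext x
        simp only [map_add, AddMonoidHom.add_apply, AddMonoidHom.comp_apply,
          AddMonoidHom.smul_apply, btmulHom_apply, smul_add]
        abel))
    (fun ω a x => by
      have h1 : X.dForm m (op a • ω) =
          op a • X.dForm m ω + (-1 : ℤ) ^ m • X.wedge m 1 ω (X.d0 a) := form_ext (by
        simp [X.diff_mul m _ (X.val_mem ω)])
      have h2 : ∀ (c : ℤ) (β : X.Form (m + 1)) (y : F), btmul A (c • β) y = c • btmul A β y := by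
        intro c β y
        exact congrArg (fun g : F →+ X.Om (m + 1) F => g y) (map_zsmul (btmulHom A) c β)
      simp only [AddMonoidHom.mk'_apply, AddMonoidHom.add_apply, AddMonoidHom.comp_apply,
        AddMonoidHom.smul_apply, btmulHom_apply, LinearMap.toAddMonoidHom_coe, map_smul, hs,
        map_add, h1, h2, btmul_smul, wedgeLeft_op_smul, wedgeLeft_btmul, smul_add]
      abel)

@[simp] theorem extend_btmul (m : ℕ) (p : G →ₗ[A] F) (s : G →+ X.Om 1 F)
    (hs : ∀ (a : A) (x : G), s (a • x) = btmul A (X.d0 a) (p x) + a • s x)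
    (ω : X.Form m) (x : G) :
    X.extend m p s hs (btmul A ω x) =
      btmul A (X.dForm m ω) (p x) + (-1 : ℤ) ^ m • X.wedgeLeft m 1 F ω (s x) := rfl

end FormsWithValues

/-! ### The first jet functor -/

/-- The product `A ⊗ A → A`. -/
def mulHom : A ⊗[k] A →+ A :=
  TensorProduct.liftAddHom AddMonoidHom.mul (fun r a b => by simp)

@[simp] theorem mulHom_tmul (a b : A) : mulHom (k := k) (a ⊗ₜ[k] b) = a * b := rfl

theorem d0_smul (r : k) (a : A) : X.val (X.d0 (r • a)) = r • X.val (X.d0 a) := by simp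

/-- The map `A ⊗ A → Ω¹`, `a ⊗ b ↦ a db`. -/
def aDb : A ⊗[k] A →+ X.Form 1 :=
  TensorProduct.liftAddHom
    (AddMonoidHom.mk' (fun a => (DistribSMul.toAddMonoidHom (X.Form 1) a).comp X.d0)
      (fun a a' => by ext b; simp [add_smul]))
    (fun r a b => form_ext (by simp))

@[simp] theorem aDb_tmul (a b : A) : X.aDb (a ⊗ₜ[k] b) = a • X.d0 b := rfl

/-- The map `A ⊗ A → Ω¹`, `a ⊗ b ↦ (da) b`. -/
def daB : A ⊗[k] A →+ X.Form 1 :=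
  TensorProduct.liftAddHom
    (AddMonoidHom.mk' (fun a => AddMonoidHom.mk' (fun b : A => op b • X.d0 a)
        (fun b b' => by simp [add_smul]))
      (fun a a' => by ext b; simp))
    (fun r a b => form_ext (by simp [-op_smul]))

@[simp] theorem daB_tmul (a b : A) : X.daB (a ⊗ₜ[k] b) = op b • X.d0 a := rfl

theorem mulHom_smul (c : A) (t : A ⊗[k] A) : mulHom (c • t) = c * mulHom t := by
  induction t using TensorProduct.induction_on with
  | zero => simp
  | tmul a b => simp [TensorProduct.smul_tmul', mul_assoc]
  | add x y hx hy => simp only [smul_add, map_add, hx, hy, mul_add]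

theorem aDb_smul (c : A) (t : A ⊗[k] A) : X.aDb (c • t) = c • X.aDb t := by
  induction t using TensorProduct.induction_on with
  | zero => simp
  | tmul a b => simp [TensorProduct.smul_tmul', mul_smul]
  | add x y hx hy => simp only [smul_add, map_add, hx, hy]

theorem daB_eq (t : A ⊗[k] A) : X.daB t = X.d0 (mulHom t) - X.aDb t := by
  induction t using TensorProduct.induction_on with
  | zero => simp
  | tmul a b => simp [d0_mul]
  | add x y hx hy => simp only [map_add, hx, hy]; abel

/-- The module `N = {∑ aᵢ ⊗ bᵢ | ∑ aᵢ bᵢ = 0, ∑ aᵢ dbᵢ = 0}`. -/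
def jetRel : Submodule A (A ⊗[k] A) where
  carrier := {t | mulHom t = 0 ∧ X.aDb t = 0}
  zero_mem' := ⟨map_zero _, map_zero _⟩
  add_mem' := by
    rintro s t ⟨h1, h2⟩ ⟨h3, h4⟩
    exact ⟨by rw [map_add, h1, h3, add_zero], by rw [map_add, h2, h4, add_zero]⟩
  smul_mem' := by
    rintro c t ⟨h1, h2⟩
    exact ⟨by rw [mulHom_smul, h1, mul_zero], by rw [aDb_smul, h2, smul_zero]⟩

/-- The `A`-bimodule `J¹A = (A ⊗ A) / N`. Its left action is multiplication on the first factor,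
its right action multiplication on the second one. -/
def JetA : Type u := (A ⊗[k] A) ⧸ X.jetRel

instance : AddCommGroup X.JetA := inferInstanceAs (AddCommGroup ((A ⊗[k] A) ⧸ X.jetRel))
instance : Module A X.JetA := inferInstanceAs (Module A ((A ⊗[k] A) ⧸ X.jetRel))

/-- The class of an element of `A ⊗ A` in `J¹A`. -/
def jmk : A ⊗[k] A →ₗ[A] X.JetA := X.jetRel.mkQ

theorem jmk_surjective : Function.Surjective X.jmk := X.jetRel.mkQ_surjective

/-- Multiplication of the second factor of `A ⊗ A` by `c` on the right. -/
def rmulT (c : A) : A ⊗[k] A →ₗ[A] A ⊗[k] A :=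
  TensorProduct.AlgebraTensorModule.map LinearMap.id (LinearMap.mulRight k c)

@[simp] theorem rmulT_tmul (a b c : A) : rmulT (k := k) c (a ⊗ₜ[k] b) = a ⊗ₜ[k] (b * c) := rfl

theorem mulHom_rmulT (c : A) (t : A ⊗[k] A) : mulHom (rmulT c t) = mulHom t * c := by
  induction t using TensorProduct.induction_on with
  | zero => simp
  | tmul a b => simp [mul_assoc]
  | add x y hx hy => simp only [map_add, hx, hy, add_mul]

theorem aDb_rmulT (c : A) (t : A ⊗[k] A) :
    X.aDb (rmulT c t) = op c • X.aDb t + mulHom t • X.d0 c := by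
  induction t using TensorProduct.induction_on with
  | zero => simp
  | tmul a b => simp [d0_mul, mul_smul, smul_comm a (op c)]
  | add x y hx hy => simp only [map_add, hx, hy, smul_add, add_smul]; abel

/-- Right multiplication by `c` on `J¹A`. -/
def rmulJ (c : A) : X.JetA →ₗ[A] X.JetA :=
  Submodule.mapQ X.jetRel X.jetRel (rmulT c) (by
    rintro t ⟨h1, h2⟩
    exact ⟨by rw [mulHom_rmulT, h1, zero_mul], by rw [aDb_rmulT, h1, h2]; simp⟩)

@[simp] theorem rmulJ_jmk (c : A) (t : A ⊗[k] A) : X.rmulJ c (X.jmk t) = X.jmk (rmulT c t) := rfl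

theorem jetA_hom_ext {f g : X.JetA →ₗ[A] X.JetA}
    (h : ∀ a b : A, f (X.jmk (a ⊗ₜ b)) = g (X.jmk (a ⊗ₜ b))) (x : X.JetA) : f x = g x := by
  obtain ⟨t, rfl⟩ := X.jmk_surjective x
  induction t using TensorProduct.induction_on with
  | zero => simp
  | tmul a b => exact h a b
  | add x y hx hy => simp only [map_add, hx, hy]

instance : Module Aᵐᵒᵖ X.JetA where
  smul c x := X.rmulJ c.unop x
  one_smul x := X.jetA_hom_ext (f := X.rmulJ 1) (g := LinearMap.id) (fun a b => by simp) x
  mul_smul c c' x := X.jetA_hom_ext (f := X.rmulJ (c'.unop * c.unop))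
    (g := X.rmulJ c.unop ∘ₗ X.rmulJ c'.unop) (fun a b => by simp [mul_assoc]) x
  smul_zero c := map_zero (X.rmulJ c.unop)
  smul_add c x y := map_add (X.rmulJ c.unop) x y
  add_smul c c' x := X.jetA_hom_ext (f := X.rmulJ (c.unop + c'.unop))
    (g := X.rmulJ c.unop + X.rmulJ c'.unop)
    (fun a b => by simp [mul_add, TensorProduct.tmul_add]) x
  zero_smul x := X.jetA_hom_ext (f := X.rmulJ 0) (g := 0) (fun a b => by simp) x

theorem op_smul_jmk (c : A) (t : A ⊗[k] A) : op c • X.jmk t = X.jmk (rmulT c t) := rfl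

@[simp] theorem op_smul_jmk_tmul (a b c : A) :
    op c • X.jmk (a ⊗ₜ[k] b) = X.jmk (a ⊗ₜ[k] (b * c)) := rfl

instance : SMulCommClass A Aᵐᵒᵖ X.JetA where
  smul_comm a c x := (map_smul (X.rmulJ c.unop) a x).symm

/-- The additive map on `J¹A` induced by one on `A ⊗ A` that vanishes on `N`. -/
def jetALift {G : Type*} [AddCommGroup G] (f : A ⊗[k] A →+ G) (hf : ∀ t ∈ X.jetRel, f t = 0) :
    X.JetA →+ G :=
  QuotientAddGroup.lift X.jetRel.toAddSubgroup f hf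

@[simp] theorem jetALift_jmk {G : Type*} [AddCommGroup G] (f : A ⊗[k] A →+ G)
    (hf : ∀ t ∈ X.jetRel, f t = 0) (t : A ⊗[k] A) : X.jetALift f hf (X.jmk t) = f t := rfl

/-- The jet projection `J¹A → A`, `[a ⊗ b] ↦ a b`. -/
def projA : X.JetA →+ A := X.jetALift mulHom (fun _ h => h.1)

/-- The map `J¹A → Ω¹`, `[a ⊗ b] ↦ a db`. -/
def aDbA : X.JetA →+ X.Form 1 := X.jetALift X.aDb (fun _ h => h.2)

/-- The Spencer operator `J¹A → Ω¹`, `[a ⊗ b] ↦ (da) b`. -/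
def spencerA : X.JetA →+ X.Form 1 :=
  X.jetALift X.daB (fun t h => by rw [daB_eq, h.1, h.2]; simp)

@[simp] theorem projA_jmk (t : A ⊗[k] A) : X.projA (X.jmk t) = mulHom t := rfl
@[simp] theorem aDbA_jmk (t : A ⊗[k] A) : X.aDbA (X.jmk t) = X.aDb t := rfl
@[simp] theorem spencerA_jmk (t : A ⊗[k] A) : X.spencerA (X.jmk t) = X.daB t := rfl

theorem projA_smul (c : A) (x : X.JetA) : X.projA (c • x) = c * X.projA x := by
  obtain ⟨t, rfl⟩ := X.jmk_surjective x
  rw [← map_smul, projA_jmk, projA_jmk, mulHom_smul]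

theorem projA_op_smul (c : A) (x : X.JetA) : X.projA (op c • x) = X.projA x * c := by
  obtain ⟨t, rfl⟩ := X.jmk_surjective x
  rw [op_smul_jmk, projA_jmk, projA_jmk, mulHom_rmulT]

theorem aDbA_smul (c : A) (x : X.JetA) : X.aDbA (c • x) = c • X.aDbA x := by
  obtain ⟨t, rfl⟩ := X.jmk_surjective x
  rw [← map_smul, aDbA_jmk, aDbA_jmk, aDb_smul]

theorem aDbA_op_smul (c : A) (x : X.JetA) :
    X.aDbA (op c • x) = op c • X.aDbA x + X.projA x • X.d0 c := by
  obtain ⟨t, rfl⟩ := X.jmk_surjective x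
  rw [op_smul_jmk, aDbA_jmk, aDbA_jmk, aDb_rmulT, projA_jmk]

theorem spencerA_eq (x : X.JetA) : X.spencerA x = X.d0 (X.projA x) - X.aDbA x := by
  obtain ⟨t, rfl⟩ := X.jmk_surjective x
  rw [spencerA_jmk, daB_eq, projA_jmk, aDbA_jmk]

theorem spencerA_smul (c : A) (x : X.JetA) :
    X.spencerA (c • x) = op (X.projA x) • X.d0 c + c • X.spencerA x := by
  rw [spencerA_eq, spencerA_eq, projA_smul, aDbA_smul, d0_mul, smul_sub]
  abel

theorem spencerA_op_smul (c : A) (x : X.JetA) :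
    X.spencerA (op c • x) = op c • X.spencerA x := by
  rw [spencerA_eq, spencerA_eq, projA_op_smul, aDbA_op_smul, d0_mul, smul_sub]
  abel

theorem jetA_ext {x y : X.JetA} (h1 : X.projA x = X.projA y) (h2 : X.aDbA x = X.aDbA y) :
    x = y := by
  obtain ⟨s, rfl⟩ := X.jmk_surjective x
  obtain ⟨t, rfl⟩ := X.jmk_surjective y
  refine (Submodule.Quotient.eq X.jetRel).2 ⟨?_, ?_⟩
  · rw [map_sub, sub_eq_zero]; exact h1
  · rw [map_sub, sub_eq_zero]; exact h2

theorem aDb_surjective : Function.Surjective X.aDb := by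
  intro ω
  have key : ∀ x ∈ Submodule.span k
      {x | ∃ (a : A) (b : Fin 1 → A),
        x = X.incl a * (List.ofFn fun i => X.diff (X.incl (b i))).prod},
      ∃ t, X.val (X.aDb t) = x := by
    intro x hx
    induction hx using Submodule.span_induction with
    | mem x hx =>
      obtain ⟨a, b, rfl⟩ := hx
      exact ⟨a ⊗ₜ b 0, by simp⟩
    | zero => exact ⟨0, by simp⟩
    | add x y _ _ hx hy =>
      obtain ⟨s, rfl⟩ := hx
      obtain ⟨t, rfl⟩ := hy
      exact ⟨s + t, by simp⟩
    | smul r x _ hx =>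
      obtain ⟨t, rfl⟩ := hx
      exact ⟨algebraMap k A r • t, by
        rw [aDb_smul, val_smul, AlgHom.commutes, Algebra.smul_def]⟩
  obtain ⟨t, ht⟩ := key _ (X.grade_le_span 1 ω.2)
  exact ⟨t, form_ext ht⟩

theorem exists_iotaA (ω : X.Form 1) : ∃ x : X.JetA, X.projA x = 0 ∧ X.aDbA x = ω := by
  obtain ⟨t, rfl⟩ := X.aDb_surjective ω
  refine ⟨X.jmk (t - mulHom t ⊗ₜ 1), ?_, ?_⟩
  · simp
  · have : X.d0 1 = 0 := by
      have h := X.d0_mul 1 1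
      simp only [mul_one, op_one, one_smul] at h
      exact left_eq_add.mp h
    simp [this]

/-- The inclusion `Ω¹ → J¹A`, `∑ aᵢ dbᵢ ↦ ∑ [aᵢ ⊗ bᵢ - aᵢ bᵢ ⊗ 1]`: the unique element of the
kernel of `[a ⊗ b] ↦ a b` that `[a ⊗ b] ↦ a db` maps to the given form. -/
def iotaA : X.Form 1 →+ X.JetA :=
  AddMonoidHom.mk' (fun ω => (X.exists_iotaA ω).choose) (fun ω ω' => by
    have h := (X.exists_iotaA ω).choose_spec
    have h' := (X.exists_iotaA ω').choose_spec
    have h'' := (X.exists_iotaA (ω + ω')).choose_spec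
    refine X.jetA_ext ?_ ?_
    · rw [h''.1, map_add, h.1, h'.1, add_zero]
    · rw [h''.2, map_add, h.2, h'.2])

@[simp] theorem projA_iotaA (ω : X.Form 1) : X.projA (X.iotaA ω) = 0 :=
  (X.exists_iotaA ω).choose_spec.1

@[simp] theorem aDbA_iotaA (ω : X.Form 1) : X.aDbA (X.iotaA ω) = ω :=
  (X.exists_iotaA ω).choose_spec.2

theorem iotaA_aDb (a b : A) :
    X.iotaA (a • X.d0 b) = X.jmk (a ⊗ₜ b) - X.jmk ((a * b) ⊗ₜ 1) := by
  have : X.d0 1 = 0 := by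
    have h := X.d0_mul 1 1
    simp only [mul_one, op_one, one_smul] at h
    exact left_eq_add.mp h
  refine X.jetA_ext ?_ ?_ <;> simp [this]

theorem iotaA_smul (c : A) (ω : X.Form 1) : X.iotaA (c • ω) = c • X.iotaA ω := by
  refine X.jetA_ext ?_ ?_
  · simp [projA_smul]
  · simp [aDbA_smul]

theorem iotaA_op_smul (c : A) (ω : X.Form 1) : X.iotaA (op c • ω) = op c • X.iotaA ω := by
  refine X.jetA_ext ?_ ?_
  · simp [projA_op_smul]
  · simp [aDbA_op_smul]

theorem spencerA_iotaA (ω : X.Form 1) : X.spencerA (X.iotaA ω) = -ω := by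
  rw [spencerA_eq]; simp

section FirstJets

variable {F : Type u} [AddCommGroup F] [Module A F]
variable {G : Type u} [AddCommGroup G] [Module A G]

/-- The first jet module `J¹F = J¹A ⊗_A F`. -/
abbrev J1 (F : Type u) [AddCommGroup F] [Module A F] : Type u := BTensor A X.JetA F

/-- The functor `J¹` on morphisms. -/
abbrev J1Map (φ : F →ₗ[A] G) : X.J1 F →ₗ[A] X.J1 G := btensorMap X.JetA φ

variable (F) in
/-- The jet projection `π : J¹F → F`, `[a ⊗ b] ⊗ f ↦ a b f`. -/
def proj1 : X.J1 F →ₗ[A] F where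
  toFun := btensorLift
    (AddMonoidHom.mk' (fun x => DistribSMul.toAddMonoidHom F (X.projA x))
      (fun x y => by ext f; simp [add_smul]))
    (fun x a f => by simp [projA_op_smul, mul_smul])
  map_add' := map_add _
  map_smul' a x := by
    induction x using btensor_induction with
    | zero => simp
    | tmul x f => simp [smul_btmul, projA_smul, mul_smul]
    | add x y hx hy => simp only [smul_add, map_add, hx, hy]

@[simp] theorem proj1_btmul (x : X.JetA) (f : F) : X.proj1 F (btmul A x f) = X.projA x • f := rfl

variable (F) in
/-- The prolongation `j : F → J¹F`, `f ↦ [1 ⊗ 1] ⊗ f`. -/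
def prol1 : F →+ X.J1 F := btmulHom A (X.jmk (1 ⊗ₜ 1))

theorem prol1_apply (f : F) : X.prol1 F f = btmul A (X.jmk (1 ⊗ₜ 1)) f := rfl

variable (F) in
/-- The inclusion `ι : Ω¹F → J¹F`, `a db ⊗ f ↦ [a ⊗ b - a b ⊗ 1] ⊗ f`. -/
def iota1 : X.Om 1 F →ₗ[A] X.J1 F where
  toFun := btensorLift ((btmulHom A).comp X.iotaA)
    (fun ω a f => by simp [iotaA_op_smul, btmul_smul])
  map_add' := map_add _
  map_smul' a x := by
    induction x using btensor_induction with
    | zero => simp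
    | tmul ω f => simp [smul_btmul, iotaA_smul]
    | add x y hx hy => simp only [smul_add, map_add, hx, hy]

@[simp] theorem iota1_btmul (ω : X.Form 1) (f : F) :
    X.iota1 F (btmul A ω f) = btmul A (X.iotaA ω) f := rfl

variable (F) in
/-- The Spencer operator `J¹F → Ω¹F`, `[a ⊗ b] ⊗ f ↦ (da) b ⊗ f`. -/
def spencer1 : X.J1 F →+ X.Om 1 F :=
  btensorLift ((btmulHom A).comp X.spencerA)
    (fun x a f => by simp [spencerA_op_smul, btmul_smul])

@[simp] theorem spencer1_btmul (x : X.JetA) (f : F) :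
    X.spencer1 F (btmul A x f) = btmul A (X.spencerA x) f := rfl

theorem spencer1_smul (a : A) (x : X.J1 F) :
    X.spencer1 F (a • x) = btmul A (X.d0 a) (X.proj1 F x) + a • X.spencer1 F x := by
  induction x using btensor_induction with
  | zero => simp [← btmulHom_apply]
  | tmul x f => simp [smul_btmul, spencerA_smul, add_btmul, btmul_smul]
  | add x y hx hy => simp only [smul_add, map_add, hx, hy, btmul_add]; abel

theorem proj1_iota1 (ξ : X.Om 1 F) : X.proj1 F (X.iota1 F ξ) = 0 := by
  induction ξ using btensor_induction with
  | zero => simp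
  | tmul ω f => simp
  | add x y hx hy => simp only [map_add, hx, hy, add_zero]

theorem spencer1_iota1 (ξ : X.Om 1 F) : X.spencer1 F (X.iota1 F ξ) = -ξ := by
  induction ξ using btensor_induction with
  | zero => simp
  | tmul ω f =>
    rw [iota1_btmul, spencer1_btmul, spencerA_iotaA]
    exact congrArg (fun g : F →+ X.Om 1 F => g f) (map_neg (btmulHom A) ω)
  | add x y hx hy => simp only [map_add, hx, hy]; abel

theorem proj1_prol1 (f : F) : X.proj1 F (X.prol1 F f) = f := by simp [prol1_apply]

theorem d0_one : X.d0 1 = 0 := by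
  have h := X.d0_mul 1 1
  simp only [mul_one, op_one, one_smul] at h
  exact left_eq_add.mp h

theorem spencer1_prol1 (f : F) : X.spencer1 F (X.prol1 F f) = 0 := by
  rw [prol1_apply, spencer1_btmul, spencerA_jmk, daB_tmul, d0_one, smul_zero]
  exact congrArg (fun g : F →+ X.Om 1 F => g f) (map_zero (btmulHom A))

theorem prol1_map (φ : F →ₗ[A] G) (f : F) : X.J1Map φ (X.prol1 F f) = X.prol1 G (φ f) := rfl

theorem iota1_map (φ : F →ₗ[A] G) (ξ : X.Om 1 F) :
    X.J1Map φ (X.iota1 F ξ) = X.iota1 G (X.OmMap 1 φ ξ) := by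
  induction ξ using btensor_induction with
  | zero => simp
  | tmul ω f => rfl
  | add x y hx hy => simp only [map_add, hx, hy]

/-! ### The operator whose kernel defines the holonomic jets -/

variable (F) in
/-- The Spencer operator `Ωᵐ J¹F → Ωᵐ⁺¹ F`, `ω ⊗ [a ⊗ b] ⊗ f ↦ d(ω a) b ⊗ f`, given by the formula
`ω ⊗ x ↦ dω ⊗ π x + (-1)ᵐ ω ∧ S x`. -/
def spencerForm (m : ℕ) : X.Om m (X.J1 F) →+ X.Om (m + 1) F :=
  X.extend m (X.proj1 F) (X.spencer1 F) X.spencer1_smul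

theorem spencerForm_btmul (m : ℕ) (ω : X.Form m) (a b : A) (f : F) :
    X.spencerForm F m (btmul A ω (btmul A (X.jmk (a ⊗ₜ b)) f)) =
      btmul A (op b • X.dForm m (op a • ω)) f := by
  have h1 : X.dForm m (op a • ω) =
      op a • X.dForm m ω + (-1 : ℤ) ^ m • X.wedge m 1 ω (X.d0 a) := form_ext (by
    simp [X.diff_mul m _ (X.val_mem ω)])
  have h2 : ∀ (c : ℤ) (β : X.Form (m + 1)) (y : F), btmul A (c • β) y = c • btmul A β y := by
    intro c β y
    exact congrArg (fun g : F →+ X.Om (m + 1) F => g y) (map_zsmul (btmulHom A) c β)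
  have h3 : ∀ (c : ℤ) (β : X.Form (m + 1)), op b • c • β = c • op b • β :=
    fun c β => (smul_comm _ _ _)
  rw [spencerForm, extend_btmul, proj1_btmul, projA_jmk, mulHom_tmul, spencer1_btmul,
    spencerA_jmk, daB_tmul, wedgeLeft_btmul, h1, smul_add, add_btmul, mul_smul, btmul_smul,
    btmul_smul, h3, h2, smul_smul]
  congr 3
  exact form_ext (by simp [mul_assoc])

variable (F) in
/-- The first component `D^I : J¹J¹F → Ω¹F`, `[a ⊗ b] ⊗ [c ⊗ e] ⊗ f ↦ a d(b c) e ⊗ f`, of the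
operator `D`. -/
def DI : X.J1 (X.J1 F) →+ X.Om 1 F :=
  btensorLift
    (AddMonoidHom.mk'
      (fun z => ((btmulHom A (X.aDbA z)).comp (X.proj1 F).toAddMonoidHom +
        (DistribSMul.toAddMonoidHom (X.Om 1 F) (X.projA z)).comp (X.spencer1 F)))
      (fun z z' => by
        ext x
        simp only [map_add, AddMonoidHom.add_apply, AddMonoidHom.comp_apply,
          DistribSMul.toAddMonoidHom_apply, add_smul]
        abel))
    (fun z a x => by
      simp only [AddMonoidHom.mk'_apply, AddMonoidHom.add_apply, AddMonoidHom.comp_apply,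
        btmulHom_apply, LinearMap.toAddMonoidHom_coe, DistribSMul.toAddMonoidHom_apply,
        aDbA_op_smul, projA_op_smul, spencer1_smul, add_btmul, map_smul, btmul_smul, smul_add,
        mul_smul, smul_btmul]
      abel)

theorem DI_btmul (z : X.JetA) (x : X.J1 F) :
    X.DI F (btmul A z x) =
      btmul A (X.aDbA z) (X.proj1 F x) + X.projA z • X.spencer1 F x := rfl

theorem DI_tmul (a b c e : A) (f : F) :
    X.DI F (btmul A (X.jmk (a ⊗ₜ b)) (btmul A (X.jmk (c ⊗ₜ e)) f)) =
      btmul A (op e • a • X.d0 (b * c)) f := by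
  rw [DI_btmul, proj1_btmul, spencer1_btmul, projA_jmk, projA_jmk, aDbA_jmk, spencerA_jmk,
    mulHom_tmul, mulHom_tmul, aDb_tmul, daB_tmul, btmul_smul, smul_btmul, ← add_btmul]
  congr 1
  exact form_ext (by simp [mul_smul, X.diff_mul 0 _ (X.incl_mem b), mul_add, add_mul, mul_assoc])

variable (F) in
/-- The second component `D^II : J¹J¹F → Ω²F`,
`[a ⊗ b] ⊗ [c ⊗ e] ⊗ f ↦ da ∧ d(b c) e ⊗ f`, of the operator `D`. -/
def DII : X.J1 (X.J1 F) →+ X.Om (1 + 1) F :=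
  -(X.spencerForm F 1).comp (X.spencer1 (X.J1 F))

theorem DII_tmul (a b c e : A) (f : F) :
    X.DII F (btmul A (X.jmk (a ⊗ₜ b)) (btmul A (X.jmk (c ⊗ₜ e)) f)) =
      btmul A (op e • X.wedge 1 1 (X.d0 a) (X.d0 (b * c))) f := by
  have h2 : ∀ (β : X.Form (1 + 1)) (y : F), btmul A (-β) y = -btmul A β y := by
    intro β y
    exact congrArg (fun g : F →+ X.Om (1 + 1) F => g y) (map_neg (btmulHom A) β)
  rw [DII, AddMonoidHom.neg_apply, AddMonoidHom.comp_apply, spencer1_btmul, spencerA_jmk, daB_tmul,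
    spencerForm_btmul, ← h2]
  congr 1
  refine form_ext ?_
  have h1 : X.diff (X.diff (X.incl a) * X.incl b * X.incl c) =
      -(X.diff (X.incl a) * X.diff (X.incl (b * c))) := by
    rw [mul_assoc, ← map_mul, X.diff_mul 1 _ (X.diff_mem 0 _ (X.incl_mem a)), X.diff_diff]
    simp
  simp [-Nat.reduceAdd, h1]

/-- `D^II (a x) = da ∧ D^I x + a D^II x`, that is, `D = (D^I, D^II)` is left linear into
`Ω¹F × Ω²F` with the action `a (α, β) = (a α, da ∧ α + a β)`. -/
theorem DII_smul (a : A) (x : X.J1 (X.J1 F)) :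
    X.DII F (a • x) = X.wedgeLeft 1 1 F (X.d0 a) (X.DI F x) + a • X.DII F x := by
  induction x using btensor_induction with
  | zero => simp
  | add x y hx hy => simp only [smul_add, map_add, hx, hy]; abel
  | tmul z x =>
    obtain ⟨t, rfl⟩ := X.jmk_surjective z
    induction t using TensorProduct.induction_on with
    | zero => simp [← btmulHom_apply]
    | add s t hs ht => simp only [map_add, add_btmul, smul_add, hs, ht]; abel
    | tmul b c =>
      induction x using btensor_induction with
      | zero => simp [← btmulHom_apply]
      | add x y hx hy => simp only [map_add, btmul_add, smul_add, hx, hy]; abel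
      | tmul z x =>
        obtain ⟨t, rfl⟩ := X.jmk_surjective z
        induction t using TensorProduct.induction_on with
        | zero => simp [← btmulHom_apply]
        | add s t hs ht => simp only [map_add, add_btmul, btmul_add, smul_add, hs, ht]; abel
        | tmul e g =>
          rw [smul_btmul, ← map_smul, TensorProduct.smul_tmul', DII_tmul, DII_tmul, DI_tmul,
            wedgeLeft_btmul, smul_btmul, ← add_btmul]
          congr 1
          exact form_ext (by
            simp [-Nat.reduceAdd, X.diff_mul 0 _ (X.incl_mem a), add_mul,
              mul_assoc])

theorem DI_smul (a : A) (x : X.J1 (X.J1 F)) : X.DI F (a • x) = a • X.DI F x := by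
  induction x using btensor_induction with
  | zero => simp
  | add x y hx hy => simp only [smul_add, map_add, hx, hy]
  | tmul z x => simp only [smul_btmul, DI_btmul, aDbA_smul, projA_smul, smul_add, mul_smul]

theorem DI_prol1 (x : X.J1 F) : X.DI F (X.prol1 _ x) = X.spencer1 F x := by
  rw [prol1_apply, DI_btmul]
  simp [d0_one, ← btmulHom_apply]

theorem DII_prol1 (x : X.J1 F) : X.DII F (X.prol1 _ x) = 0 := by
  rw [DII, AddMonoidHom.neg_apply, AddMonoidHom.comp_apply, spencer1_prol1, map_zero, neg_zero]

theorem DI_iota1 (ξ : X.Om 1 (X.J1 F)) : X.DI F (X.iota1 _ ξ) = X.OmMap 1 (X.proj1 F) ξ := by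
  induction ξ using btensor_induction with
  | zero => simp
  | add x y hx hy => simp only [map_add, hx, hy]
  | tmul ω x => simp [DI_btmul]

theorem DII_iota1 (ξ : X.Om 1 (X.J1 F)) : X.DII F (X.iota1 _ ξ) = X.spencerForm F 1 ξ := by
  rw [DII, AddMonoidHom.neg_apply, AddMonoidHom.comp_apply, spencer1_iota1, map_neg, neg_neg]

end FirstJets

/-! ### Holonomic jets -/

/-- For a map `l : H → J¹G`, the kernel of `D ∘ J¹(l) : J¹H → J¹J¹G → Ω¹G × Ω²G`. -/
def holonomic {G H : Type u} [AddCommGroup G] [Module A G] [AddCommGroup H] [Module A H]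
    (l : H →ₗ[A] X.J1 G) : Submodule A (X.J1 H) where
  carrier := {x | X.DI G (X.J1Map l x) = 0 ∧ X.DII G (X.J1Map l x) = 0}
  zero_mem' := by simp
  add_mem' := by
    rintro x y ⟨h1, h2⟩ ⟨h3, h4⟩
    exact ⟨by rw [map_add, map_add, h1, h3, add_zero], by rw [map_add, map_add, h2, h4, add_zero]⟩
  smul_mem' := by
    rintro a x ⟨h1, h2⟩
    exact ⟨by rw [map_smul, DI_smul, h1, smul_zero],
      by rw [map_smul, DII_smul, h1, h2, map_zero, smul_zero, add_zero]⟩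

/-- Two consecutive jet modules together with the inclusion `Jⁿ⁺¹E → J¹JⁿE`. -/
structure JetStage where
  low : ModuleCat.{u} A
  high : ModuleCat.{u} A
  incl : high →ₗ[A] X.J1 low

variable (E : Type u) [AddCommGroup E] [Module A E]

/-- The recursion `J⁰E = E`, `J¹E = J¹A ⊗_A E`,
`Jⁿ⁺²E = ker (J¹Jⁿ⁺¹E → J¹J¹JⁿE → Ω¹JⁿE × Ω²JⁿE)`. -/
def jetStage : ℕ → X.JetStage
  | 0 => ⟨ModuleCat.of A E, ModuleCat.of A (X.J1 E), LinearMap.id⟩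
  | n + 1 => ⟨(jetStage n).high, ModuleCat.of A (X.holonomic (jetStage n).incl),
      (X.holonomic (jetStage n).incl).subtype⟩

/-- The holonomic `n`-jet module `JⁿE`. -/
def Jet (n : ℕ) : ModuleCat.{u} A := (X.jetStage E n).low

/-- The inclusion `l : Jⁿ⁺¹E → J¹JⁿE`. -/
def jetIncl (n : ℕ) : X.Jet E (n + 1) →ₗ[A] X.J1 (X.Jet E n) := (X.jetStage E n).incl

/-- The jet projection `π : Jⁿ⁺¹E → JⁿE`. -/
def jetProj (n : ℕ) : X.Jet E (n + 1) →ₗ[A] X.Jet E n := X.proj1 (X.Jet E n) ∘ₗ X.jetIncl E n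

/-- The Spencer operator `S : Jⁿ⁺¹E → Ω¹JⁿE`, `∑ [y ⊗ z] ⊗ ξ ↦ ∑ (dy) z ⊗ ξ`. -/
def spencer (n : ℕ) : X.Jet E (n + 1) →+ X.Om 1 (X.Jet E n) :=
  (X.spencer1 (X.Jet E n)).comp (X.jetIncl E n).toAddMonoidHom

theorem jetIncl_injective (n : ℕ) : Function.Injective (X.jetIncl E n) := by
  cases n with
  | zero => exact Function.injective_id
  | succ n => exact Submodule.subtype_injective _

/-- The elements of `J¹Jⁿ⁺¹E` in `Jⁿ⁺²E`. -/
theorem exists_jetIncl_eq {n : ℕ} {x : X.J1 (X.Jet E (n + 1))}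
    (h1 : X.DI _ (X.J1Map (X.jetIncl E n) x) = 0)
    (h2 : X.DII _ (X.J1Map (X.jetIncl E n) x) = 0) : ∃ y, X.jetIncl E (n + 1) y = x :=
  ⟨(⟨x, h1, h2⟩ : X.holonomic (X.jetStage E n).incl), rfl⟩

theorem DI_jetIncl (n : ℕ) (y : X.Jet E (n + 2)) :
    X.DI _ (X.J1Map (X.jetIncl E n) (X.jetIncl E (n + 1) y)) = 0 :=
  (show (X.holonomic (X.jetStage E n).incl) from y).2.1

theorem DII_jetIncl (n : ℕ) (y : X.Jet E (n + 2)) :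
    X.DII _ (X.J1Map (X.jetIncl E n) (X.jetIncl E (n + 1) y)) = 0 :=
  (show (X.holonomic (X.jetStage E n).incl) from y).2.2

/-- The corestriction to `Jⁿ⁺²E` of a linear map into `J¹Jⁿ⁺¹E`. -/
def jetLift (n : ℕ) {G : Type u} [AddCommGroup G] [Module A G]
    (φ : G →ₗ[A] X.J1 (X.Jet E (n + 1)))
    (h1 : ∀ g, X.DI _ (X.J1Map (X.jetIncl E n) (φ g)) = 0)
    (h2 : ∀ g, X.DII _ (X.J1Map (X.jetIncl E n) (φ g)) = 0) : G →ₗ[A] X.Jet E (n + 2) :=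
  LinearMap.codRestrict (X.holonomic (X.jetStage E n).incl) φ (fun g => ⟨h1 g, h2 g⟩)

theorem jetIncl_jetLift (n : ℕ) {G : Type u} [AddCommGroup G] [Module A G]
    (φ : G →ₗ[A] X.J1 (X.Jet E (n + 1)))
    (h1 : ∀ g, X.DI _ (X.J1Map (X.jetIncl E n) (φ g)) = 0)
    (h2 : ∀ g, X.DII _ (X.J1Map (X.jetIncl E n) (φ g)) = 0) :
    X.jetIncl E (n + 1) ∘ₗ X.jetLift E n φ h1 h2 = φ := rfl

/-- The jet prolongations `E → JⁿE` and `E → Jⁿ⁺¹E`, the second one being the corestriction of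
`j¹ ∘ jⁿ : E → JⁿE → J¹JⁿE`. -/
def prolAux : ∀ n : ℕ, {p : (E →+ X.Jet E n) × (E →+ X.Jet E (n + 1)) //
    ∀ e, X.jetIncl E n (p.2 e) = X.prol1 _ (p.1 e)}
  | 0 => ⟨(AddMonoidHom.id E, X.prol1 E), fun _ => rfl⟩
  | n + 1 => by
    have hn := (prolAux n).2
    have h1 : ∀ e, X.DI _ (X.J1Map (X.jetIncl E n) (X.prol1 _ ((prolAux n).1.2 e))) = 0 := by
      intro e; rw [prol1_map, hn, DI_prol1, spencer1_prol1]
    have h2 : ∀ e, X.DII _ (X.J1Map (X.jetIncl E n) (X.prol1 _ ((prolAux n).1.2 e))) = 0 := by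
      intro e; rw [prol1_map, DII_prol1]
    exact ⟨((prolAux n).1.2,
      AddMonoidHom.codRestrict ((X.prol1 _).comp (prolAux n).1.2)
        (X.holonomic (X.jetStage E n).incl) (fun e => ⟨h1 e, h2 e⟩)), fun _ => rfl⟩

/-- The `n`-jet prolongation `jⁿ : E → JⁿE`. -/
def prol (n : ℕ) : E →+ X.Jet E n := (X.prolAux E n).1.1

theorem jetIncl_prol (n : ℕ) (e : E) :
    X.jetIncl E n (X.prol E (n + 1) e) = X.prol1 _ (X.prol E n e) := (X.prolAux E n).2 e

/-- Every `n`-jet is elemental: `JⁿE = A jⁿ(E)`. -/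
def AllJetsElemental (n : ℕ) : Prop :=
  Submodule.span A (Set.range (X.prol E n)) = ⊤

/-! ### Symmetric forms -/

/-- Two consecutive modules of symmetric forms with the inclusion `Sⁿ⁺¹E → Ω¹SⁿE`. -/
structure SymStage where
  low : ModuleCat.{u} A
  high : ModuleCat.{u} A
  incl : high →ₗ[A] X.Om 1 low

/-- The Spencer `δ`-map `Ω¹H → Ω¹Ω¹G → Ω²G`, up to sign, for `w : H → Ω¹G`. -/
def delta {G H : Type u} [AddCommGroup G] [Module A G] [AddCommGroup H] [Module A H]
    (w : H →ₗ[A] X.Om 1 G) : X.Om 1 H →ₗ[A] X.Om (1 + 1) G :=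
  X.wedgeT 1 1 G ∘ₗ X.OmMap 1 w

/-- The recursion `S⁰E = E`, `S¹E = Ω¹E`, `Sⁿ⁺²E = ker (Ω¹Sⁿ⁺¹E → Ω¹Ω¹SⁿE → Ω²SⁿE)`. -/
def symStage : ℕ → X.SymStage
  | 0 => ⟨ModuleCat.of A E, ModuleCat.of A (X.Om 1 E), LinearMap.id⟩
  | n + 1 => ⟨(symStage n).high, ModuleCat.of A (LinearMap.ker (X.delta (symStage n).incl)),
      (LinearMap.ker (X.delta (symStage n).incl)).subtype⟩

/-- The module `SⁿE` of symmetric `n`-forms with values in `E`. -/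
def Sym (n : ℕ) : ModuleCat.{u} A := (X.symStage E n).low

/-- The inclusion `Sⁿ⁺¹E → Ω¹SⁿE`. -/
def symIncl (n : ℕ) : X.Sym E (n + 1) →ₗ[A] X.Om 1 (X.Sym E n) := (X.symStage E n).incl

theorem delta_symIncl (n : ℕ) (s : X.Sym E (n + 2)) :
    X.delta (X.symIncl E n) (X.symIncl E (n + 1) s) = 0 :=
  (show LinearMap.ker (X.delta (X.symStage E n).incl) from s).2

theorem symIncl_injective (n : ℕ) : Function.Injective (X.symIncl E n) := by
  cases n with
  | zero => exact Function.injective_id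
  | succ n => exact Submodule.subtype_injective _

/-- The Spencer operator `Ω¹J' → Ω¹J¹J → Ω²J` restricts to `Ω¹S' → Ω²S`, for maps `i : S → J` and
`i' : S' → J'` that are compatible with `w : S' → Ω¹S` and `l : J' → J¹J`. -/
theorem spencerForm_compat {S S' J J' : Type u} [AddCommGroup S] [Module A S] [AddCommGroup S']
    [Module A S'] [AddCommGroup J] [Module A J] [AddCommGroup J'] [Module A J']
    (w : S' →ₗ[A] X.Om 1 S) (l : J' →ₗ[A] X.J1 J) (i : S →ₗ[A] J) (i' : S' →ₗ[A] J')
    (h : l ∘ₗ i' = X.iota1 J ∘ₗ X.OmMap 1 i ∘ₗ w) (x : X.Om 1 S') :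
    X.spencerForm J 1 (X.OmMap 1 l (X.OmMap 1 i' x)) = X.OmMap (1 + 1) i (X.delta w x) := by
  induction x using btensor_induction with
  | zero => simp
  | add x y hx hy => simp only [map_add, hx, hy]
  | tmul ω s =>
    have hs : l (i' s) = X.iota1 J (X.OmMap 1 i (w s)) := LinearMap.congr_fun h s
    rw [delta, LinearMap.comp_apply, btensorMap_btmul, btensorMap_btmul, btensorMap_btmul,
      wedgeT_btmul, hs, ← wedgeLeft_map]
    rw [spencerForm, extend_btmul, proj1_iota1, spencer1_iota1, pow_one, map_neg, smul_neg,
      neg_smul, one_smul, neg_neg]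
    simp [← btmulHom_apply]

/-- The maps `SⁿE → JⁿE` and `Sⁿ⁺¹E → Jⁿ⁺¹E`, the second one being the corestriction of
`ι¹ ∘ Ω¹(ιⁿ) : Sⁿ⁺¹E → Ω¹SⁿE → Ω¹JⁿE → J¹JⁿE`. -/
def iotaAux : ∀ n : ℕ,
    {p : (X.Sym E n →ₗ[A] X.Jet E n) × (X.Sym E (n + 1) →ₗ[A] X.Jet E (n + 1)) //
      X.jetIncl E n ∘ₗ p.2 = X.iota1 _ ∘ₗ X.OmMap 1 p.1 ∘ₗ X.symIncl E n}
  | 0 => ⟨(LinearMap.id, X.iota1 E), by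
      ext x
      change X.iota1 E x = X.iota1 E (X.OmMap 1 LinearMap.id x)
      congr 1
      induction x using btensor_induction with
      | zero => simp
      | add x y hx hy => rw [map_add, ← hx, ← hy]
      | tmul ω s => rfl⟩
  | n + 1 => by
    have hn := (iotaAux n).2
    refine ⟨((iotaAux n).1.2,
      X.jetLift E n (X.iota1 _ ∘ₗ X.OmMap 1 (iotaAux n).1.2 ∘ₗ X.symIncl E (n + 1)) ?_ ?_), rfl⟩
    · intro s
      rw [LinearMap.comp_apply, iota1_map, DI_iota1, LinearMap.comp_apply]
      have key : ∀ x : X.Om 1 (X.Sym E (n + 1)), X.OmMap 1 (X.proj1 (X.Jet E n))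
          (X.OmMap 1 (X.jetIncl E n) (X.OmMap 1 (iotaAux n).1.2 x)) = 0 := by
        intro x
        induction x using btensor_induction with
        | zero => simp
        | add x y hx hy => rw [map_add, map_add, map_add, hx, hy, add_zero]
        | tmul ω s =>
          have hs := LinearMap.congr_fun hn s
          simp only [LinearMap.comp_apply] at hs
          rw [btensorMap_btmul, btensorMap_btmul, btensorMap_btmul, hs, proj1_iota1]
          exact map_zero (btmulHom A ω)
      exact key _
    · intro s
      rw [LinearMap.comp_apply, iota1_map, DII_iota1, LinearMap.comp_apply,
        X.spencerForm_compat _ _ _ _ hn, delta_symIncl, map_zero]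

/-- The map `ιⁿ : SⁿE → JⁿE`. -/
def jetIota (n : ℕ) : X.Sym E n →ₗ[A] X.Jet E n := (X.iotaAux E n).1.1

theorem jetIncl_jetIota (n : ℕ) : X.jetIncl E n ∘ₗ X.jetIota E (n + 1) =
    X.iota1 _ ∘ₗ X.OmMap 1 (X.jetIota E n) ∘ₗ X.symIncl E n := (X.iotaAux E n).2

/-! ### The jet sequence -/

/-- Left exactness of the `n`-jet sequence `0 → SⁿE → JⁿE → Jⁿ⁻¹E → 0`. For `n = 0`, where
`J⁻¹E = 0`, the sequence is `0 → E = E → 0 → 0`, which is exact. -/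
def JetSequenceLeftExact : ℕ → Prop
  | 0 => True
  | n + 1 => Function.Injective (X.jetIota E (n + 1)) ∧
      Function.Exact (X.jetIota E (n + 1)) (X.jetProj E n)

/-- Exactness of the `n`-jet sequence `0 → SⁿE → JⁿE → Jⁿ⁻¹E → 0`. -/
def JetSequenceExact : ℕ → Prop
  | 0 => True
  | n + 1 => X.JetSequenceLeftExact E (n + 1) ∧ Function.Surjective (X.jetProj E n)

/-! ### Connections -/

/-- A left `(n + 1)`-connection on `E`: a left linear section `JⁿE → Jⁿ⁺¹E` of the jet
projection. -/
abbrev HigherConnection (n : ℕ) : Type u :=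
  {C : X.Jet E n →ₗ[A] X.Jet E (n + 1) // X.jetProj E n ∘ₗ C = LinearMap.id}

/-- A left connection on a left `A`-module `F`: a `k`-linear map `∇ : F → Ω¹F` satisfying the
Leibniz rule, where `k` acts on left `A`-modules through `A`. -/
structure Connection (F : Type u) [AddCommGroup F] [Module A F] where
  nabla : F →+ X.Om 1 F
  map_scalar : ∀ (c : k) (x : F), nabla (algebraMap k A c • x) = algebraMap k A c • nabla x
  leibniz : ∀ (a : A) (x : F), nabla (a • x) = btmul A (X.d0 a) x + a • nabla x

variable {X} in
/-- The exterior covariant derivative `Ωᵐ F → Ωᵐ⁺¹ F`, `ω ⊗ x ↦ dω ⊗ x + (-1)ᵐ ω ∧ ∇x`. -/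
def Connection.extDer {F : Type u} [AddCommGroup F] [Module A F] (D : X.Connection F) (m : ℕ) :
    X.Om m F →+ X.Om (m + 1) F :=
  X.extend m LinearMap.id D.nabla D.leibniz

variable {X} in
/-- The curvature `d_∇ ∘ ∇ : F → Ω²F`. -/
def Connection.curvature {F : Type u} [AddCommGroup F] [Module A F] (D : X.Connection F) :
    F →+ X.Om 2 F :=
  (D.extDer 1).comp D.nabla

variable {X E} in
/-- The connection `∇` on `JⁿE` projects to the Spencer operator: `Ω¹(π) ∘ ∇ = S` as maps
`JⁿE → Ω¹Jⁿ⁻¹E`. There is no condition for `n = 0`, where `J⁻¹E = 0`. -/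
def ProjectsToSpencer : ∀ {n : ℕ}, X.Connection (X.Jet E n) → Prop
  | 0, _ => True
  | n + 1, D => ∀ x, X.OmMap 1 (X.jetProj E n) (D.nabla x) = X.spencer E n x

variable {X E} in
/-- The curvature of the connection `∇` on `JⁿE` takes values in `Ω²SⁿE`. -/
def CurvatureSymmetric {n : ℕ} (D : X.Connection (X.Jet E n)) : Prop :=
  ∀ x, ∃ s : X.Om 2 (X.Sym E n), X.OmMap 2 (X.jetIota E n) s = D.curvature x

/-- The connections on `JⁿE` that project to the Spencer operator and whose curvature takes values
in `Ω²SⁿE`. -/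
abbrev SpencerConnection (n : ℕ) : Type u :=
  {D : X.Connection (X.Jet E n) // ProjectsToSpencer D ∧ CurvatureSymmetric D}

end ExtAlg

end NCJet

end

/-! Everything rests on the additive splitting `prol1_proj1_sub_iota1_spencer1`: an element `x` of
`J¹F` equals `j¹(π x) - ι¹(S x)`, so `π x` and `S x` are free coordinates on `J¹F`. For a section
`C` of the jet projection this forces `l ∘ C = j¹ - ι¹ ∘ ∇` with `∇ = S ∘ C`. Conversely, since
`j¹(a f) = a j¹(f) + ι¹(da ⊗ f)`, the map `j¹ - ι¹ ∘ ∇` is `A`-linear as soon as `∇` satisfies the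
Leibniz rule. Hence connections on `JⁿE` are the linear sections of `J¹JⁿE → JⁿE`, and it remains to
see which of them land in `Jⁿ⁺¹E`.

For `n = 0` there is nothing to check. Otherwise landing in `Jⁿ⁺¹E` means that `D^I` and `D^II`
vanish. On `j¹ x - ι¹(∇x)` the first is `S x - Ω¹(π)(∇x)`, whose vanishing is condition 1. Under
condition 1, `Ω¹(l)` followed by the Spencer operator on forms agrees with `Ω²(π) ∘ d_∇`, so the
second is `-Ω²(π)(R_∇ x)` (`DII_eq_zero_iff`). If `Ω²` is flat and the `n`-jet sequence is left
exact, the kernel of `Ω²(π)` is the image of `Ω²(ιⁿ)`, and this is condition 2.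

For the inverse description, left exactness of the `(n + 1)`-jet sequence turns `id - C ∘ π` into `ι
∘ L` for a retraction `L`, and the operator is `L ∘ jⁿ⁺¹`. Applying `l` to `C ∘ π + ι ∘ L = id` on
prolongations gives its defining equation. Uniqueness of the operator comes from injectivity of `ι`,
uniqueness of the lift from elementality of the jets. -/

noncomputable section

namespace NCJet

/-! ### Right exactness of `M ⊗_A -`, and exactness for flat `M` -/

section BalancedTensor

variable {A : Type u} [Ring A]
variable {M : Type u} [AddCommGroup M] [Module A M] [Module Aᵐᵒᵖ M] [SMulCommClass A Aᵐᵒᵖ M]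
variable {E F G : Type u} [AddCommGroup E] [Module A E] [AddCommGroup F] [Module A F]
  [AddCommGroup G] [Module A G]

theorem btensorMap_comp (φ : E →ₗ[A] F) (ψ : F →ₗ[A] G) (x : BTensor A M E) :
    btensorMap M ψ (btensorMap M φ x) = btensorMap M (ψ ∘ₗ φ) x := by
  induction x using btensor_induction with
  | zero => simp
  | tmul m e => rfl
  | add x y hx hy => simp only [map_add, hx, hy]

theorem btensorMap_id (x : BTensor A M E) :
    btensorMap M (LinearMap.id : E →ₗ[A] E) x = x := by
  induction x using btensor_induction with
  | zero => simp
  | tmul m e => rfl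
  | add x y hx hy => rw [map_add, hx, hy]

theorem btensorMap_zero (x : BTensor A M E) : btensorMap M (0 : E →ₗ[A] F) x = 0 := by
  induction x using btensor_induction with
  | zero => simp
  | tmul m e => exact map_zero (btmulHom A m)
  | add x y hx hy => rw [map_add, hx, hy, add_zero]

/-- Right exactness of `M ⊗_A -`: the kernel of `M ⊗ F → M ⊗ F/N` comes from `M ⊗ E` when `N` is the
range of `E → F`. -/
theorem exists_btensorMap_eq_of_mkQ_eq_zero (i : E →ₗ[A] F) (y : BTensor A M F)
    (hy : btensorMap M (LinearMap.range i).mkQ y = 0) : ∃ s, btensorMap M i s = y := by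
  let R := LinearMap.range (btensorMap M i)
  let f : M →+ F →+ (BTensor A M F ⧸ R) := AddMonoidHom.mk'
    (fun m => (R.mkQ.toAddMonoidHom).comp (btmulHom A m))
    (fun m m' => by ext e; simp)
  have hf : ∀ m, ∀ e ∈ (LinearMap.range i).toAddSubgroup, f m e = 0 := by
    rintro m _ ⟨e, rfl⟩
    exact (Submodule.Quotient.mk_eq_zero R).2 ⟨btmul A m e, rfl⟩
  -- This induces a map from `M ⊗ F/N` to the cokernel of `M ⊗ i`. Composed with `M ⊗ F → M ⊗ F/N`
  -- it is the cokernel projection, so whatever dies in `M ⊗ F/N` lies in the range of `M ⊗ i`.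
  let g : M →+ (F ⧸ LinearMap.range i) →+ (BTensor A M F ⧸ R) := AddMonoidHom.mk'
    (fun m => QuotientAddGroup.lift (LinearMap.range i).toAddSubgroup (f m) (hf m))
    (fun m m' => by
      ext e
      obtain ⟨e, rfl⟩ := Submodule.Quotient.mk_surjective _ e
      exact congrArg (fun h : F →+ (BTensor A M F ⧸ R) => h e) (map_add f m m'))
  have hg : ∀ (m : M) (a : A) (e : F ⧸ LinearMap.range i), g (op a • m) e = g m (a • e) := by
    intro m a e
    obtain ⟨e, rfl⟩ := Submodule.Quotient.mk_surjective _ e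
    exact congrArg R.mkQ (btmul_smul m a e).symm
  have key : ∀ z, btensorLift g hg (btensorMap M (LinearMap.range i).mkQ z) = R.mkQ z := by
    intro z
    induction z using btensor_induction with
    | zero => simp
    | tmul m e => rfl
    | add x y hx hy => simp only [map_add, hx, hy]
  have h := key y
  rw [hy, map_zero] at h
  exact (Submodule.Quotient.mk_eq_zero R).1 h.symm

/-- The map `p` factors through an injection `F/range i → G`, which stays injective after tensoring
by flatness. This reduces the kernel of `M ⊗ p` to that of `M ⊗ F → M ⊗ F/range i`, where right
exactness applies. -/
theorem IsRightFlat.exact (hM : IsRightFlat A M) {i : E →ₗ[A] F} {p : F →ₗ[A] G}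
    (h : Function.Exact i p) : Function.Exact (btensorMap M i) (btensorMap M p) := by
  intro y
  constructor
  · intro hy
    have hk : LinearMap.ker p = LinearMap.range i := LinearMap.exact_iff.1 h
    let q : (F ⧸ LinearMap.range i) →ₗ[A] G := (LinearMap.range i).liftQ p hk.ge
    have hq : Function.Injective q := by
      rw [← LinearMap.ker_eq_bot, Submodule.ker_liftQ_eq_bot _ _ _ hk.le]
    refine exists_btensorMap_eq_of_mkQ_eq_zero i y (hM _ _ q hq ?_)
    rw [btensorMap_comp, map_zero, ← hy]
    congr 1
  · rintro ⟨s, rfl⟩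
    rw [btensorMap_comp, h.linearMap_comp_eq_zero, btensorMap_zero]

end BalancedTensor

namespace ExtAlg

variable {k : Type v} {A : Type u} [CommRing k] [Ring A] [Algebra k A] (X : ExtAlg k A)

theorem d0_algebraMap (c : k) : X.d0 (algebraMap k A c) = 0 := by
  refine form_ext ?_
  have h : X.diff (X.incl 1) = 0 := by rw [← val_d0, d0_one, map_zero]
  rw [val_d0, Algebra.algebraMap_eq_smul_one, map_smul, map_smul, h, smul_zero, map_zero]

/-! ### The additive splitting of the first jet module -/

section FirstJets

variable {F : Type u} [AddCommGroup F] [Module A F]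

/-- The additive splitting `J¹F = F ⊕ Ω¹F`. -/
theorem prol1_proj1_sub_iota1_spencer1 (x : X.J1 F) :
    X.prol1 F (X.proj1 F x) - X.iota1 F (X.spencer1 F x) = x := by
  induction x using btensor_induction with
  | zero => simp
  | add x y hx hy =>
    conv_rhs => rw [← hx, ← hy]
    simp only [map_add]; abel
  | tmul z f =>
    -- The splitting already holds in `J¹A`, where elements are detected by `[a ⊗ b] ↦ a b` and `[a
    -- ⊗ b] ↦ a db`. In the second coordinate it is the Leibniz rule `d(a b) = a db + (da) b`.
    have h : op (X.projA z) • X.jmk (1 ⊗ₜ 1) = z + X.iotaA (X.spencerA z) := by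
      refine X.jetA_ext ?_ ?_
      · simp
      · rw [map_add, aDbA_iotaA, spencerA_eq]; simp
    rw [proj1_btmul, spencer1_btmul, iota1_btmul, prol1_apply, btmul_smul, h, add_btmul,
      add_sub_cancel_right]

/-- The Spencer operator is a left inverse up to sign, so no flatness is needed. -/
theorem iota1_injective : Function.Injective (X.iota1 F) := by
  intro x y h
  have := congrArg (X.spencer1 F) h
  rwa [spencer1_iota1, spencer1_iota1, neg_inj] at this

theorem prol1_algebraMap_smul (c : k) (f : F) :
    X.prol1 F (algebraMap k A c • f) = algebraMap k A c • X.prol1 F f := by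
  rw [prol1_apply, prol1_apply, btmul_smul, smul_btmul]
  congr 1
  refine X.jetA_ext ?_ ?_
  · simp [projA_smul]
  · simp [aDbA_smul, d0_algebraMap, d0_one]

/-- The defect of linearity of `j¹` is the Leibniz rule. -/
theorem prol1_smul (a : A) (f : F) :
    X.prol1 F (a • f) = a • X.prol1 F f + X.iota1 F (btmul A (X.d0 a) f) := by
  -- The coordinates of `a j¹(f)` are `a f` and `da ⊗ f`, because `S` kills prolongations.
  have h := X.prol1_proj1_sub_iota1_spencer1 (a • X.prol1 F f)
  rw [spencer1_smul, spencer1_prol1, smul_zero, add_zero, map_smul, proj1_prol1] at h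
  rw [← h, sub_add_cancel]

end FirstJets

/-! ### Prolongations, and the unconditional facts about 1-jets -/

section Jets

variable (E : Type u) [AddCommGroup E] [Module A E]

theorem jetProj_prol (n : ℕ) (e : E) : X.jetProj E n (X.prol E (n + 1) e) = X.prol E n e := by
  rw [jetProj, LinearMap.comp_apply, jetIncl_prol, proj1_prol1]

theorem jetProj_jetIota (n : ℕ) (s : X.Sym E (n + 1)) :
    X.jetProj E n (X.jetIota E (n + 1) s) = 0 := by
  have h := LinearMap.congr_fun (X.jetIncl_jetIota E n) s
  rw [jetProj, LinearMap.comp_apply]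
  exact (congrArg (X.proj1 _) h).trans (X.proj1_iota1 _)

theorem jetIncl_eq (n : ℕ) (x : X.Jet E (n + 1)) :
    X.jetIncl E n x = X.prol1 _ (X.jetProj E n x) - X.iota1 _ (X.spencer E n x) :=
  (X.prol1_proj1_sub_iota1_spencer1 (X.jetIncl E n x)).symm

theorem spencer_smul (n : ℕ) (a : A) (x : X.Jet E (n + 1)) :
    X.spencer E n (a • x) = btmul A (X.d0 a) (X.jetProj E n x) + a • X.spencer E n x := by
  have h := X.spencer1_smul a (X.jetIncl E n x)
  rw [← map_smul] at h
  exact h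

theorem prol_algebraMap_smul (n : ℕ) (c : k) (e : E) :
    X.prol E n (algebraMap k A c • e) = algebraMap k A c • X.prol E n e := by
  induction n with
  | zero => rfl
  | succ n ih =>
    apply X.jetIncl_injective E n
    rw [(X.jetIncl E n).map_smul, jetIncl_prol, jetIncl_prol, ih, prol1_algebraMap_smul]

/-- `J¹E = A j¹(E)`. -/
theorem allJetsElemental_one : X.AllJetsElemental E 1 := by
  refine Submodule.eq_top_iff'.2 fun x => ?_
  change X.J1 E at x
  induction x using btensor_induction with
  | zero => exact zero_mem _
  | add x y hx hy => exact add_mem hx hy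
  | tmul z f =>
    obtain ⟨t, rfl⟩ := X.jmk_surjective z
    induction t using TensorProduct.induction_on with
    | zero =>
      rw [map_zero, show btmul A (0 : X.JetA) f = 0 by simp [← btmulHom_apply]]
      exact zero_mem _
    | add s t hs ht =>
      rw [map_add, add_btmul]
      exact add_mem hs ht
    | tmul a b =>
      -- Moving `b` across the tensor sign exhibits a generator as a multiple of a prolongation.
      have h : btmul A (X.jmk (a ⊗ₜ b)) f = a • X.prol1 E (b • f) := by
        rw [prol1_apply, btmul_smul, smul_btmul, op_smul_jmk_tmul, ← map_smul,
          TensorProduct.smul_tmul', smul_eq_mul, mul_one, one_mul]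
      rw [h]
      exact Submodule.smul_mem _ _ (Submodule.subset_span ⟨b • f, rfl⟩)

/-- By the splitting, a 1-jet `x` with `π x = 0` is `ι¹(-S x)`; the prolongation gives surjectivity.
-/
theorem jetSequenceExact_one : X.JetSequenceExact E 1 := by
  refine ⟨⟨X.iota1_injective, fun x => ⟨fun hx => ?_, ?_⟩⟩,
    fun e => ⟨X.prol E 1 e, X.jetProj_prol E 0 e⟩⟩
  · refine ⟨(-X.spencer1 E x : X.Om 1 E), ?_⟩
    have h := X.prol1_proj1_sub_iota1_spencer1 (F := E) x
    rw [show X.proj1 E x = 0 from hx, map_zero, zero_sub, ← map_neg] at h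
    exact h
  · rintro ⟨s, rfl⟩
    exact X.jetProj_jetIota E 0 s

/-! ### Holonomy of `j¹ x - ι¹ ξ` in terms of projection and curvature -/

theorem DI_J1Map_prol1_sub_iota1 (n : ℕ) (x : X.Jet E (n + 1))
    (ξ : X.Om 1 (X.Jet E (n + 1))) :
    X.DI _ (X.J1Map (X.jetIncl E n) (X.prol1 _ x - X.iota1 _ ξ)) =
      X.spencer E n x - X.OmMap 1 (X.jetProj E n) ξ := by
  rw [map_sub, map_sub, prol1_map, iota1_map, DI_prol1, DI_iota1, btensorMap_comp]
  rfl

theorem DII_J1Map_prol1_sub_iota1 (n : ℕ) (x : X.Jet E (n + 1))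
    (ξ : X.Om 1 (X.Jet E (n + 1))) :
    X.DII _ (X.J1Map (X.jetIncl E n) (X.prol1 _ x - X.iota1 _ ξ)) =
      -X.spencerForm _ 1 (X.OmMap 1 (X.jetIncl E n) ξ) := by
  rw [map_sub, map_sub, prol1_map, iota1_map, DII_prol1, DII_iota1, zero_sub]

/-- For a connection that projects to the Spencer operator, the exterior covariant derivative
projects to the Spencer operator on forms. -/
theorem ProjectsToSpencer.OmMap_extDer {n : ℕ} {D : X.Connection (X.Jet E (n + 1))}
    (hD : ProjectsToSpencer D) (ξ : X.Om 1 (X.Jet E (n + 1))) :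
    X.OmMap (1 + 1) (X.jetProj E n) (D.extDer 1 ξ) =
      X.spencerForm _ 1 (X.OmMap 1 (X.jetIncl E n) ξ) := by
  induction ξ using btensor_induction with
  | zero => simp
  | add x y hx hy => simp only [map_add, hx, hy]
  | tmul ω x =>
    -- Both sides become `dω ⊗ π x - ω ∧ S x`, the hypothesis replacing `Ω¹(π)(∇x)` by `S x`.
    rw [btensorMap_btmul, spencerForm, extend_btmul, Connection.extDer, extend_btmul, map_add,
      btensorMap_btmul, map_zsmul, ← wedgeLeft_map, hD x]
    rfl

/-- Translates the second holonomy equation into a statement about curvature; this is where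
condition 1 feeds into condition 2. -/
theorem DII_eq_zero_iff {n : ℕ} {D : X.Connection (X.Jet E (n + 1))}
    (hD : ProjectsToSpencer D) (x : X.Jet E (n + 1)) :
    X.DII _ (X.J1Map (X.jetIncl E n) (X.prol1 _ x - X.iota1 _ (D.nabla x))) = 0 ↔
      X.OmMap 2 (X.jetProj E n) (D.curvature x) = 0 := by
  rw [DII_J1Map_prol1_sub_iota1, neg_eq_zero, ← hD.OmMap_extDer]
  rfl

/-! ### The bijection between higher connections and connections -/

variable {E}

/-- The connection `S ∘ C` on `JⁿE` of an `(n + 1)`-connection `C`. -/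
def HigherConnection.toConnection {n : ℕ} (C : X.HigherConnection E n) :
    X.Connection (X.Jet E n) where
  nabla := (X.spencer E n).comp C.1.toAddMonoidHom
  map_scalar c x := by
    -- Linearity over `k` is the Leibniz rule with `dc = 0`.
    have h := X.spencer_smul E n (algebraMap k A c) (C.1 x)
    rw [d0_algebraMap, show btmul A (0 : X.Form 1) (X.jetProj E n (C.1 x)) = 0 by
      simp [← btmulHom_apply], zero_add, ← map_smul] at h
    exact h
  leibniz a x := by
    have h := X.spencer_smul E n a (C.1 x)
    rw [← map_smul, show X.jetProj E n (C.1 x) = x from LinearMap.congr_fun C.2 x] at h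
    exact h

theorem HigherConnection.toConnection_nabla {n : ℕ} (C : X.HigherConnection E n)
    (x : X.Jet E n) : (HigherConnection.toConnection X C).nabla x = X.spencer E n (C.1 x) := rfl

theorem HigherConnection.jetIncl_apply {n : ℕ} (C : X.HigherConnection E n) (x : X.Jet E n) :
    X.jetIncl E n (C.1 x) =
      X.prol1 _ x - X.iota1 _ ((HigherConnection.toConnection X C).nabla x) := by
  rw [jetIncl_eq, show X.jetProj E n (C.1 x) = x from LinearMap.congr_fun C.2 x,
    HigherConnection.toConnection_nabla]

theorem HigherConnection.projectsToSpencer {n : ℕ} (C : X.HigherConnection E n) :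
    ProjectsToSpencer (HigherConnection.toConnection X C) := by
  cases n with
  | zero => trivial
  | succ n =>
    intro x
    have h := X.DI_jetIncl E n (C.1 x)
    rw [HigherConnection.jetIncl_apply, DI_J1Map_prol1_sub_iota1, sub_eq_zero] at h
    exact h.symm

/-- Holonomy only says that `Ω²(π)` kills the curvature. Flatness of `Ω²` and left exactness are
what lift it to `Ω²SⁿE`. -/
theorem HigherConnection.curvatureSymmetric {n : ℕ} (C : X.HigherConnection E n)
    (h2 : n ≠ 0 → IsRightFlat A (X.Form 2)) (hn : X.JetSequenceLeftExact E n) :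
    CurvatureSymmetric (HigherConnection.toConnection X C) := by
  cases n with
  -- Here `ι⁰` is the identity, so the curvature is its own preimage.
  | zero => exact fun x => ⟨_, btensorMap_id _⟩
  | succ n =>
    intro x
    refine ((h2 n.succ_ne_zero).exact hn.2 _).1 ?_
    rw [← X.DII_eq_zero_iff E (HigherConnection.projectsToSpencer X C),
      ← HigherConnection.jetIncl_apply]
    exact X.DII_jetIncl E n (C.1 x)

/-- The linear splitting `j¹ - ι¹ ∘ ∇` of the `1`-jet sequence at `F`. -/
def Connection.splitting {F : Type u} [AddCommGroup F] [Module A F] (D : X.Connection F) :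
    F →ₗ[A] X.J1 F where
  toFun x := X.prol1 _ x - X.iota1 _ (D.nabla x)
  map_add' x y := by simp only [map_add]; abel
  map_smul' a x := by
    -- The terms `ι¹(da ⊗ x)` from `j¹` and from `∇` cancel.
    rw [prol1_smul, D.leibniz, map_add, map_smul, RingHom.id_apply, smul_sub]
    abel

/-- Conditions 1 and 2 make `D^I` and `D^II` vanish on the splitting. This direction uses only `π ∘
ι = 0`, neither flatness nor exactness. -/
theorem SpencerConnection.exists_jetIncl_eq {n : ℕ} (D : X.SpencerConnection E n) :
    ∃ C : X.Jet E n →ₗ[A] X.Jet E (n + 1),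
      X.jetIncl E n ∘ₗ C = Connection.splitting X D.1 := by
  cases n with
  | zero => exact ⟨Connection.splitting X D.1, rfl⟩
  | succ n =>
    refine ⟨X.jetLift E n (Connection.splitting X D.1) (fun x => ?_) (fun x => ?_), rfl⟩
    · refine (X.DI_J1Map_prol1_sub_iota1 E n x _).trans ?_
      rw [D.2.1 x, sub_self]
    · refine (X.DII_eq_zero_iff E D.2.1 x).2 ?_
      obtain ⟨s, hs⟩ := D.2.2 x
      rw [← hs, btensorMap_comp, show X.jetProj E n ∘ₗ X.jetIota E (n + 1) = 0 from
        LinearMap.ext (X.jetProj_jetIota E n), btensorMap_zero]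

/-- The `(n + 1)`-connection of a connection on `JⁿE`, determined by `l ∘ C = j¹ - ι¹ ∘ ∇`. -/
def SpencerConnection.toHigherConnection {n : ℕ} (D : X.SpencerConnection E n) :
    X.HigherConnection E n :=
  -- The choice is harmless: `l` is injective.
  ⟨(SpencerConnection.exists_jetIncl_eq X D).choose, by
    rw [jetProj, LinearMap.comp_assoc, (SpencerConnection.exists_jetIncl_eq X D).choose_spec]
    ext x
    change X.proj1 _ (X.prol1 _ x - X.iota1 _ (D.1.nabla x)) = x
    rw [map_sub, proj1_prol1, proj1_iota1, sub_zero]⟩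

theorem SpencerConnection.jetIncl_toHigherConnection {n : ℕ} (D : X.SpencerConnection E n)
    (x : X.Jet E n) :
    X.jetIncl E n ((SpencerConnection.toHigherConnection X D).1 x) =
      X.prol1 _ x - X.iota1 _ (D.1.nabla x) :=
  LinearMap.congr_fun (SpencerConnection.exists_jetIncl_eq X D).choose_spec x

theorem Connection.ext_nabla {F : Type u} [AddCommGroup F] [Module A F] {D D' : X.Connection F}
    (h : ∀ x, D.nabla x = D'.nabla x) : D = D' := by
  cases D
  cases D'
  congr 1
  exact AddMonoidHom.ext h

/-- The correspondence between `(n + 1)`-connections on `E` and connections on `JⁿE`. -/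
def higherConnectionEquiv (n : ℕ) (h2 : n ≠ 0 → IsRightFlat A (X.Form 2))
    (hn : X.JetSequenceLeftExact E n) : X.HigherConnection E n ≃ X.SpencerConnection E n where
  toFun C := ⟨HigherConnection.toConnection X C, HigherConnection.projectsToSpencer X C,
    HigherConnection.curvatureSymmetric X C h2 hn⟩
  invFun D := SpencerConnection.toHigherConnection X D
  left_inv C := by
    refine Subtype.ext (LinearMap.ext fun x => X.jetIncl_injective E n ?_)
    rw [SpencerConnection.jetIncl_toHigherConnection, HigherConnection.jetIncl_apply]
  right_inv D := by
    refine Subtype.ext (Connection.ext_nabla X fun x => X.iota1_injective ?_)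
    have h := SpencerConnection.jetIncl_toHigherConnection X D x
    rw [HigherConnection.jetIncl_apply] at h
    exact sub_right_injective h

/-! ### The retraction onto symmetric forms -/

/-- An `(n + 1)`-connection splits the `(n + 1)`-jet sequence: the complementary retraction. -/
theorem HigherConnection.exists_retraction {n : ℕ} (C : X.HigherConnection E n)
    (h : X.JetSequenceLeftExact E (n + 1)) :
    ∃ L : X.Jet E (n + 1) →ₗ[A] X.Sym E (n + 1),
      ∀ x, C.1 (X.jetProj E n x) + X.jetIota E (n + 1) (L x) = x := by
  have hx : ∀ x, x - C.1 (X.jetProj E n x) ∈ LinearMap.range (X.jetIota E (n + 1)) := by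
    intro x
    refine (h.2 _).1 ?_
    rw [map_sub, show X.jetProj E n (C.1 (X.jetProj E n x)) = X.jetProj E n x from
      LinearMap.congr_fun C.2 _, sub_self]
  let e := LinearEquiv.ofInjective (X.jetIota E (n + 1)) h.1
  refine ⟨e.symm.toLinearMap ∘ₗ
    LinearMap.codRestrict _ (LinearMap.id - C.1 ∘ₗ X.jetProj E n) hx, fun x => ?_⟩
  have := congrArg Subtype.val (e.apply_symm_apply ⟨_, hx x⟩)
  exact add_eq_of_eq_sub' this

/-- Followed by `ι¹` this map is `l ∘ ιⁿ⁺¹`, a composite of injections. It makes the defining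
equation of the operator `E → Sⁿ⁺¹E` determine it. -/
theorem injective_OmMap_jetIota_symIncl {n : ℕ}
    (h : Function.Injective (X.jetIota E (n + 1))) :
    Function.Injective fun s => X.OmMap 1 (X.jetIota E n) (X.symIncl E n s) := by
  intro s t hst
  refine h (X.jetIncl_injective E n ?_)
  have hs := LinearMap.congr_fun (X.jetIncl_jetIota E n) s
  have ht := LinearMap.congr_fun (X.jetIncl_jetIota E n) t
  exact hs.trans ((congrArg (X.iota1 _) hst).trans ht.symm)

end Jets

end ExtAlg

end NCJet

end

/-- The higher connections are of order `n + 1`; they correspond to connections on `JⁿE`. The operator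
`Δ : E → Sⁿ⁺¹E` is a differential operator of order at most `n + 1`, with unique lift `L`. -/
theorem theorem4p18 {k : Type v} {A : Type u} [CommRing k] [Ring A] [Algebra k A]
    (X : NCJet.ExtAlg k A) (E : Type u) [AddCommGroup E] [Module A E] (n : ℕ)
    (h : n = 0 ∨
      (NCJet.IsRightFlat A (X.Form 1) ∧ NCJet.IsRightFlat A (X.Form 2) ∧
        X.AllJetsElemental E (n + 1) ∧ X.JetSequenceExact E (n + 1) ∧
        (2 ≤ n → X.JetSequenceLeftExact E n) ∧
        (3 ≤ n → Function.Injective (X.jetIota E (n - 1))))) :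
    ∃ Φ : X.HigherConnection E n ≃ X.SpencerConnection E n,
      (∀ C x, (Φ C).1.nabla x = X.spencer E n (C.1 x)) ∧
      (∀ D : X.SpencerConnection E n,
        ∃ (Δ : E →+ X.Sym E (n + 1)) (L : X.Jet E (n + 1) →ₗ[A] X.Sym E (n + 1)),
          (∀ (c : k) (e : E), Δ (algebraMap k A c • e) = algebraMap k A c • Δ e) ∧
          (∀ Δ' : E → X.Sym E (n + 1),
            (∀ e, X.OmMap 1 (X.jetIota E n) (X.symIncl E n (Δ' e)) =
              D.1.nabla (X.prol E n e)) ↔ Δ' = Δ) ∧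
          (∀ L' : X.Jet E (n + 1) →ₗ[A] X.Sym E (n + 1),
            (∀ e, L' (X.prol E (n + 1) e) = Δ e) ↔ L' = L) ∧
          (∀ s, L (X.jetIota E (n + 1) s) = s) ∧
          (∀ x, (Φ.symm D).1 (X.jetProj E n x) + X.jetIota E (n + 1) (L x) = x)) ∧
      (∀ C x, X.jetIncl E n (C.1 x) + X.iota1 _ ((Φ C).1.nabla x) = X.prol1 _ x) := by
  have hE : X.JetSequenceExact E (n + 1) ∧ X.AllJetsElemental E (n + 1) := by
    rcases h with rfl | h
    · exact ⟨X.jetSequenceExact_one E, X.allJetsElemental_one E⟩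
    · exact ⟨h.2.2.2.1, h.2.2.1⟩
  obtain ⟨⟨hE, -⟩, hel⟩ := hE
  have h2 : n ≠ 0 → NCJet.IsRightFlat A (X.Form 2) := fun hn => (h.resolve_left hn).2.1
  have hn : X.JetSequenceLeftExact E n := by
    match n, h with
    | 0, _ => trivial
    -- Left exactness one degree down is assumed only from `n = 2` on; for `n = 1` it concerns
    -- 1-jets and is automatic.
    | 1, _ => exact (X.jetSequenceExact_one E).1
    | n + 2, h => exact (h.resolve_left (by omega)).2.2.2.2.1 (by omega)
  refine ⟨X.higherConnectionEquiv n h2 hn, fun C x => rfl, fun D => ?_, fun C x => ?_⟩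
  · have hC := NCJet.ExtAlg.SpencerConnection.jetIncl_toHigherConnection X D
    obtain ⟨L, hL⟩ := NCJet.ExtAlg.HigherConnection.exists_retraction X
      (NCJet.ExtAlg.SpencerConnection.toHigherConnection X D) hE
    have hinj := X.injective_OmMap_jetIota_symIncl hE.1
    have hΔ : ∀ e, X.OmMap 1 (X.jetIota E n) (X.symIncl E n (L (X.prol E (n + 1) e))) =
        D.1.nabla (X.prol E n e) := by
      intro e
      refine X.iota1_injective ?_
      -- Under `l` the decomposition of `jⁿ⁺¹ e` has `j¹(jⁿ e)` on both sides; cancelling it leaves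
      -- the equation inside `ι¹`.
      have h1 := congrArg (X.jetIncl E n) (hL (X.prol E (n + 1) e))
      have h3 := LinearMap.congr_fun (X.jetIncl_jetIota E n) (L (X.prol E (n + 1) e))
      simp only [LinearMap.comp_apply] at h3
      rw [map_add, X.jetProj_prol, hC, h3, X.jetIncl_prol, sub_add_eq_add_sub,
        sub_eq_iff_eq_add, add_right_inj] at h1
      exact h1
    refine ⟨L.toAddMonoidHom.comp (X.prol E (n + 1)), L, fun c e => ?_,
      fun Δ' => ⟨fun h' => ?_, ?_⟩,
      fun L' => ⟨fun h' => ?_, ?_⟩, fun s => hE.1 ?_, hL⟩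
    · exact (congrArg L (X.prol_algebraMap_smul E (n + 1) c e)).trans (map_smul L _ _)
    · funext e
      exact hinj ((h' e).trans (hΔ e).symm)
    · rintro rfl e
      exact hΔ e
    -- A linear lift is determined on prolongations, since these generate the jets.
    · refine LinearMap.ext_on_range hel ?_
      exact h'
    · rintro rfl e
      rfl
    -- As `π ∘ ι = 0`, the decomposition of `ι s` reads `ι (L (ι s)) = ι s`, and `ι` is injective.
    · have := hL (X.jetIota E (n + 1) s)
      rwa [X.jetProj_jetIota, map_zero, zero_add] at this
  · exact add_eq_of_eq_sub (NCJet.ExtAlg.HigherConnection.jetIncl_apply X C x)
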